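/- A \emph{packing of unit spheres} in $\mathbb{R}^n$ (of unit circles if $n=2$) is given by a set $S\subset\mathbb{R}^n$ of centers, any two distinct ones being at distance at least $2$. It is \emph{$k$-saturated} ($k\ge 1$) if it is not possible to replace $k-1$ of its spheres by $k$ unit spheres and still have a packing, and \emph{completely saturated} if it is $k$-saturated for all $k\ge 1$. Let $v\in\mathbb{R}^n$ be a nonzero vector, $c\in\mathbb{R}$, and let $H=\{x:\langle v,x\rangle=c\}$ and $H^+=\{x:\langle v,x\rangle\ge c\}$. The packing obtained from $S$ by a \emph{gap defect along $H$ of width $\|v\|$} has the set of centers $$\widetilde S=\{x\in S: x\notin H^+\}\cup\{x+v: x\in S\cap H^+\}.$$ A \emph{honeycomb circle packing} is a packing congruent to the one with centers $(2i+j,\sqrt3\,j)$, $i,j\in\mathbb{Z}$, in $\mathbb{R}^2$; an \emph{fcc packing} is a packing congruent to the one with centers $(2i+k,2j+k,\sqrt2\,k)$, $i,j,k\in\mathbb{Z}$, in $\mathbb{R}^3$. \textbf{Theorem.} A honeycomb circle packing in $\mathbb{R}^2$ with a gap defect of any positive width along any line is not completely saturated; that is, for some $k\ge1$ one can replace $k-1$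 of its circles by $k$ unit circles and still have a packing. Likewise, an fcc sphere packing in $\mathbb{R}^3$ with a gap defect of any positive width along any plane is not completely saturated. -/

import Mathlib

/-- A packing of unit spheres in `ℝⁿ`, given by the set of its centers: distinct centers are at
distance at least `2`. -/
@[ext]
structure SpherePacking (n : ℕ) where
  centers : Set (EuclideanSpace ℝ (Fin n))
  separated : ∀ x ∈ centers, ∀ y ∈ centers, x ≠ y → 2 ≤ dist x y

namespace SpherePacking

/-- `S` is `k`-saturated: it is not possible to replace `k - 1` spheres of `S` (those centered at
the points of `A`) by `k` spheres (those centered at the points of `B`) and still have a packing.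
Disjointness says that no new sphere coincides with a sphere that was kept. -/
def IsSaturated {n : ℕ} (S : SpherePacking n) (k : ℕ) : Prop :=
  ¬ ∃ A B : Finset (EuclideanSpace ℝ (Fin n)),
    (A : Set (EuclideanSpace ℝ (Fin n))) ⊆ S.centers ∧
    A.card + 1 = k ∧ B.card = k ∧
    Disjoint (B : Set (EuclideanSpace ℝ (Fin n))) (S.centers \ A) ∧
    ∃ T : SpherePacking n, T.centers = (S.centers \ A) ∪ B

/-- `S` is `k`-saturated for all `k ≥ 1`. -/
def IsCompletelySaturated {n : ℕ} (S : SpherePacking n) : Prop :=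
  ∀ k : ℕ, 1 ≤ k → S.IsSaturated k

theorem two_le_dist_add {n : ℕ} {v x y : EuclideanSpace ℝ (Fin n)} {c : ℝ}
    (hx : c ≤ inner ℝ v x) (hy : inner ℝ v y < c) (h : 2 ≤ dist x y) : 2 ≤ dist (x + v) y := by
  refine h.trans ?_
  rw [dist_eq_norm, dist_eq_norm, show x + v - y = (x - y) + v by abel]
  refine abs_le_of_sq_le_sq' ?_ (norm_nonneg _) |>.2
  rw [norm_add_sq_real, real_inner_comm, inner_sub_right]
  nlinarith [sq_nonneg ‖v‖]

/-- The packing obtained from `S` by a hyperplane gap defect along the hyperplane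
`{x | ⟪v, x⟫ = c}`: all spheres with centers in the closed half-space `{x | c ≤ ⟪v, x⟫}` are moved
by the vector `v`, which is perpendicular to the hyperplane and points into that half-space, and
all other spheres stay. The width of the gap is `‖v‖`. -/
def gapDefect {n : ℕ} (S : SpherePacking n) (v : EuclideanSpace ℝ (Fin n)) (c : ℝ) :
    SpherePacking n where
  centers := {x ∈ S.centers | inner ℝ v x < c} ∪
    (fun x => x + v) '' {x ∈ S.centers | c ≤ inner ℝ v x}
  separated := by
    rintro x (⟨hx, hxc⟩ | ⟨x, ⟨hx, hxc⟩, rfl⟩) y (⟨hy, hyc⟩ | ⟨y, ⟨hy, hyc⟩, rfl⟩) hne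
    · exact S.separated x hx y hy hne
    · rw [dist_comm]
      refine two_le_dist_add hyc hxc (S.separated y hy x hx ?_)
      rintro rfl
      exact absurd hyc (not_le.2 hxc)
    · refine two_le_dist_add hxc hyc (S.separated x hx y hy ?_)
      rintro rfl
      exact absurd hxc (not_le.2 hyc)
    · simpa using S.separated x hx y hy (fun h => hne (by rw [h]))

/-- The honeycomb circle packing in standard position, with centers `(2i + j, √3 j)`. -/
noncomputable def honeycomb : SpherePacking 2 where
  centers := {x | ∃ i j : ℤ, x = !₂[2 * (i : ℝ) + j, √3 * j]}
  separated := by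
    rintro x ⟨i, j, rfl⟩ y ⟨k, l, rfl⟩ hne
    rw [EuclideanSpace.dist_eq]
    apply Real.le_sqrt_of_sq_le
    have h3 : √3 ^ 2 = (3 : ℝ) := Real.sq_sqrt (by norm_num)
    have key : 1 ≤ (i - k) ^ 2 + (i - k) * (j - l) + (j - l) ^ 2 := by
      by_contra hlt
      have h0 : (i - k) ^ 2 + (i - k) * (j - l) + (j - l) ^ 2 ≤ 0 := by omega
      have ha : i - k = 0 := by
        nlinarith [sq_nonneg ((i - k) + 2 * (j - l)), sq_nonneg (i - k)]
      have hb : j - l = 0 := by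
        nlinarith [sq_nonneg (2 * (i - k) + (j - l)), sq_nonneg (j - l)]
      exact hne (by rw [sub_eq_zero.1 ha, sub_eq_zero.1 hb])
    have key' : (1 : ℝ) ≤ (i - k) ^ 2 + (i - k) * (j - l) + (j - l) ^ 2 := by exact_mod_cast key
    simp [Fin.sum_univ_two, Real.dist_eq]
    linear_combination 4 * key' - (j - l : ℝ) ^ 2 * h3

/-- The fcc (face-centered cubic) sphere packing in standard position, with centers
`(2i + k, 2j + k, √2 k)`. -/
noncomputable def fcc : SpherePacking 3 where
  centers := {x | ∃ i j k : ℤ, x = !₂[2 * (i : ℝ) + k, 2 * (j : ℝ) + k, √2 * k]}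
  separated := by
    rintro x ⟨i, j, k, rfl⟩ y ⟨i', j', k', rfl⟩ hne
    rw [EuclideanSpace.dist_eq]
    apply Real.le_sqrt_of_sq_le
    have h2 : √2 ^ 2 = (2 : ℝ) := Real.sq_sqrt (by norm_num)
    have key : 1 ≤ (i - i') ^ 2 + (j - j') ^ 2 + (k - k') ^ 2 + (i - i') * (k - k')
        + (j - j') * (k - k') := by
      by_contra hlt
      have h0 : (i - i') ^ 2 + (j - j') ^ 2 + (k - k') ^ 2 + (i - i') * (k - k')
        + (j - j') * (k - k') ≤ 0 := by omega
      have hc : k - k' = 0 := by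
        nlinarith [sq_nonneg (2 * (i - i') + (k - k')), sq_nonneg (2 * (j - j') + (k - k')),
          sq_nonneg (k - k')]
      rw [hc] at h0
      have ha : i - i' = 0 := by nlinarith [sq_nonneg (i - i'), sq_nonneg (j - j')]
      have hb : j - j' = 0 := by nlinarith [sq_nonneg (i - i'), sq_nonneg (j - j')]
      exact hne (by rw [sub_eq_zero.1 ha, sub_eq_zero.1 hb, sub_eq_zero.1 hc])
    have key' : (1 : ℝ) ≤ (i - i') ^ 2 + (j - j') ^ 2 + (k - k') ^ 2 + (i - i') * (k - k')
        + (j - j') * (k - k') := by exact_mod_cast key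
    simp [Fin.sum_univ_three, Real.dist_eq]
    linear_combination 4 * key' - (k - k' : ℝ) ^ 2 * h2

/-- Two packings are congruent if an isometry of `ℝⁿ` maps one onto the other. -/
def IsCongruent {n : ℕ} (S T : SpherePacking n) : Prop :=
  ∃ e : EuclideanSpace ℝ (Fin n) ≃ᵢ EuclideanSpace ℝ (Fin n), T.centers = e '' S.centers

/-- `S` is a honeycomb packing of unit circles in the plane, in any position. -/
def IsHoneycomb (S : SpherePacking 2) : Prop := honeycomb.IsCongruent S

/-- `S` is an fcc packing of unit spheres in space, in any position. -/
def IsFCC (S : SpherePacking 3) : Prop := fcc.IsCongruent S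

end SpherePacking

/-! Both packings are root lattices: integer vectors with coordinate sum zero, in `ℝ³` or `ℝ⁴`
modulo constants. There a gap along a layer is governed by coordinate differences of its
displacement, and two points are far enough apart once two coordinates of their difference vector
differ by at least 2. An improvement involves finitely many spheres, so a gap may first be altered
at finitely many sites as long as a packing remains. If such alterations produce arbitrarily large
patches of another configuration, it suffices to improve that one (`Improvable.transfer`).

Three alterations are used. `Improvable.of_tilt` turns the hyperplane, on a large patch, into a
lattice layer. `Improvable.of_crack` spends the room in a gap: in a slab below it the spheres on the
two sides of a transversal layer are shifted by `R` and `L`, which opens a crack of displacement `L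
- R` there. `Improvable.of_widen` chooses `L` and `R` so that, up to small losses, the crack is as
wide as the gap in one direction and gains width in the others. Two such steps in different
coordinates multiply the width by at least 3/2, which needs three coordinates, that is, dimension
two. Iterating makes the gap so wide that one more sphere fits (`improvable_of_wide`).

The difficulty is to make the shifts vanish far away. They fade out by steps of size `η` over nested
shells, and each step can push neighbours together to first order in `η`. To pay for this, every
other shell is raised by `2 * α`, using a little of the gap. Between neighbours in one layer, the
raise is transversal and gains a multiple of `α ^ 2`, which beats `η`. Between neighbours in
adjacent layers it acts to first order, so it must have the right sign: the shell boundaries are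
sloped so that the upper neighbour is always in the raised shell (`shell_root_up`). About `1 / η`
shells suffice, so the change is finite. -/

namespace RootPacking

/-! ### The metric of the root lattice and tests for distance -/

section Basic

variable {ι : Type*} [Fintype ι]

/-- The sum of the squared deviations from the mean: half of the squared norm that `ℝ^(n+1)` modulo
constants carries when the vectors `x ∈ ℤ^(n+1)` with `∑ a, x a = 0` form the root lattice `Aₙ`
with minimal distance `2`. -/
noncomputable def devSq (z : ι → ℝ) : ℝ := ∑ a, z a ^ 2 - (∑ a, z a) ^ 2 / Fintype.card ι

theorem devSq_eq_sum (z : ι → ℝ) :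
    devSq z = ∑ a, (z a - (∑ b, z b) / Fintype.card ι) ^ 2 := by
  rcases isEmpty_or_nonempty ι with h | h
  · simp [devSq]
  · have hc : (Fintype.card ι : ℝ) ≠ 0 := by exact_mod_cast Fintype.card_ne_zero
    simp only [sub_sq, Finset.sum_add_distrib, Finset.sum_sub_distrib, ← Finset.sum_mul,
      ← Finset.mul_sum, Finset.sum_const, Finset.card_univ, nsmul_eq_mul, devSq]
    field_simp
    ring

theorem devSq_nonneg (z : ι → ℝ) : 0 ≤ devSq z := by
  rw [devSq_eq_sum]
  exact Finset.sum_nonneg fun _ _ => sq_nonneg _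

theorem devSq_neg (z : ι → ℝ) : devSq (fun a => -z a) = devSq z := by
  simp [devSq]

theorem devSq_sub_comm (y z : ι → ℝ) :
    devSq (fun a => y a - z a) = devSq (fun a => z a - y a) := by
  rw [← devSq_neg]
  simp

theorem devSq_add {l : ι → ℝ} (hl : ∑ a, l a = 0) (d : ι → ℝ) :
    devSq (fun a => l a + d a) = devSq l + 2 * ∑ a, l a * d a + devSq d := by
  have h : ∑ a, (l a + d a) ^ 2 = ∑ a, l a ^ 2 + 2 * ∑ a, l a * d a + ∑ a, d a ^ 2 := by
    simp only [add_sq, Finset.sum_add_distrib, Finset.mul_sum, mul_assoc]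
  rw [devSq, h, Finset.sum_add_distrib, hl, devSq, devSq, hl]
  ring

theorem sq_sub_le (z : ι → ℝ) (a b : ι) : (z a - z b) ^ 2 ≤ 2 * devSq z := by
  classical
  rcases eq_or_ne a b with rfl | hab
  · simpa using devSq_nonneg z
  rw [devSq_eq_sum]
  set μ := (∑ b, z b) / Fintype.card ι
  have h := Finset.sum_le_sum_of_subset_of_nonneg (Finset.subset_univ {a, b})
    (f := fun c => (z c - μ) ^ 2) fun _ _ _ => sq_nonneg _
  rw [Finset.sum_pair hab] at h
  nlinarith [sq_nonneg (z a - μ + (z b - μ))]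

/-- Cauchy–Schwarz against the vector with entries `2, -1, -1`, which has sum zero and squared
length 6; `sq_sub_le` is the same for a root. -/
theorem sq_two_mul_sub_le (z : ι → ℝ) {a b c : ι} (hab : a ≠ b) (hac : a ≠ c) (hbc : b ≠ c) :
    (2 * z a - z b - z c) ^ 2 ≤ 6 * devSq z := by
  classical
  rw [devSq_eq_sum]
  set μ := (∑ b, z b) / Fintype.card ι
  have h := Finset.sum_le_sum_of_subset_of_nonneg (Finset.subset_univ {a, b, c})
    (f := fun c => (z c - μ) ^ 2) fun _ _ _ => sq_nonneg _
  rw [Finset.sum_insert (by simp [hab, hac]), Finset.sum_pair hbc] at h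
  nlinarith [sq_nonneg (z a - μ + 2 * (z b - μ)), sq_nonneg (z a - μ + 2 * (z c - μ)),
    sq_nonneg (z b - z c), sq_nonneg (z a - μ + (z b - μ) + (z c - μ))]

theorem two_le_devSq {z : ι → ℝ} {a b : ι} (h : 2 ≤ z a - z b) : 2 ≤ devSq z := by
  nlinarith [sq_sub_le z a b]

omit [Fintype ι] in
theorem exists_pos_of_sum {s : Finset ι} {l : ι → ℤ} (h : 1 ≤ ∑ a ∈ s, l a) :
    ∃ a ∈ s, 1 ≤ l a := by
  by_contra! hc
  have := Finset.sum_nonpos (s := s) (f := l) fun a ha => by have := hc a ha; omega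
  omega

omit [Fintype ι] in
theorem exists_nonneg_of_sum {s : Finset ι} (hs : s.Nonempty) {l : ι → ℤ}
    (h : 0 ≤ ∑ a ∈ s, l a) : ∃ a ∈ s, 0 ≤ l a := by
  by_contra! hc
  have := Finset.sum_neg (s := s) (f := l) (fun a ha => hc a ha) hs
  omega

theorem exists_neg_of_sum {l : ι → ℤ} (hl : ∑ a, l a = 0) {p : ι} (hp : 1 ≤ l p) :
    ∃ b, l b ≤ -1 := by
  by_contra! hc
  have := Finset.single_le_sum (s := Finset.univ) (f := l)
    (fun a _ => by have := hc a; omega) (Finset.mem_univ p)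
  omega

theorem exists_pos_of_ne_zero {l : ι → ℤ} (hl : ∑ a, l a = 0) (h0 : l ≠ 0) : ∃ p, 1 ≤ l p := by
  by_contra! hc
  refine h0 (funext fun a => ?_)
  have := (Finset.sum_eq_zero_iff_of_nonpos (s := Finset.univ) (f := l)
    fun a _ => by have := hc a; omega).1 hl a (Finset.mem_univ a)
  simpa using this

theorem two_le_devSq_int {l : ι → ℤ} (hl : ∑ a, l a = 0) (h0 : l ≠ 0) :
    2 ≤ devSq (fun a => (l a : ℝ)) := by
  obtain ⟨p, hp⟩ := exists_pos_of_ne_zero hl h0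
  obtain ⟨b, hb⟩ := exists_neg_of_sum hl hp
  refine two_le_devSq (a := p) (b := b) ?_
  have : (2 : ℤ) ≤ l p - l b := by omega
  exact_mod_cast this

variable [DecidableEq ι]

/-- A displacement that does not bring the coordinates in `I` and outside of `I` closer keeps the
points of different layers apart. -/
theorem two_le_devSq_of_layer {I : Finset ι} {l : ι → ℤ} (hl : ∑ a, l a = 0)
    (hI : 1 ≤ ∑ a ∈ I, l a) {d : ι → ℝ} (hd : ∀ a ∈ I, ∀ b ∉ I, d b ≤ d a) :
    2 ≤ devSq (fun a => l a + d a) := by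
  obtain ⟨a, ha, hla⟩ := exists_pos_of_sum hI
  have hc : 1 ≤ ∑ b ∈ Iᶜ, -l b := by
    rw [Finset.sum_neg_distrib]
    have := Finset.sum_add_sum_compl I l
    omega
  obtain ⟨b, hb, hlb⟩ := exists_pos_of_sum hc
  refine two_le_devSq (a := a) (b := b) ?_
  have h1 := hd a ha b (by simpa using hb)
  have h2 : (1 : ℝ) ≤ l a := by exact_mod_cast hla
  have h3 : (1 : ℝ) ≤ -l b := by exact_mod_cast hlb
  linarith

/-- The root `ε a - ε b`. -/
def root (a b : ι) : ι → ℤ := Pi.single a 1 - Pi.single b 1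

theorem sum_root (a b : ι) : ∑ c, root a b c = 0 := by
  simp [root, Finset.sum_sub_distrib]

theorem sum_root_mul (a b : ι) (d : ι → ℝ) : ∑ c, (root a b c : ℝ) * d c = d a - d b := by
  simp [root, sub_mul, Finset.sum_sub_distrib, Pi.single_apply]

theorem devSq_root {a b : ι} (hab : a ≠ b) : devSq (fun c => (root a b c : ℝ)) = 2 := by
  have h0 : ∑ c, (root a b c : ℝ) = 0 := by exact_mod_cast sum_root a b
  have h := sum_root_mul a b fun c => (root a b c : ℝ)
  rw [devSq, h0]
  simp only [pow_two, h]
  simp [root, hab, hab.symm]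
  norm_num

/-- Displacements that are small, or that do not decrease the differences with the coordinate `p`
by much, keep apart two lattice points whose difference is not a root. -/
theorem two_le_devSq_of_not_root {l : ι → ℤ} (hl : ∑ a, l a = 0) {p : ι} (hp : 1 ≤ l p)
    (hr : ∀ b, l ≠ root p b) {d : ι → ℝ} {ε : ℝ} (hε0 : 0 ≤ ε) (hε : ε * (100 * Fintype.card ι) ≤ 1)
    (hd : ∀ c, -(ε * (1 + ∑ a, |(l a : ℝ)|)) ≤ d p - d c) :
    2 ≤ devSq (fun a => l a + d a) := by
  obtain ⟨c, -, hc⟩ := Finset.exists_min_image Finset.univ l ⟨p, Finset.mem_univ p⟩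
  obtain ⟨b, hb⟩ := exists_neg_of_sum hl hp
  have hc' : ∀ a, l c ≤ l a := fun a => hc a (Finset.mem_univ a)
  have hcneg : l c ≤ -1 := (hc' b).trans hb
  have hN : (1 : ℝ) ≤ Fintype.card ι := by
    exact_mod_cast Fintype.card_pos_iff.2 ⟨p⟩
  have habs : ∑ a, |(l a : ℝ)| ≤ 2 * Fintype.card ι * (-l c : ℝ) := by
    have h1 : ∀ a, |(l a : ℝ)| ≤ l a + 2 * (-l c : ℝ) := by
      intro a
      have h2 : (l c : ℝ) ≤ l a := by exact_mod_cast hc' a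
      have h3 : (l c : ℝ) ≤ -1 := by exact_mod_cast hcneg
      exact abs_le.2 ⟨by linarith, by linarith⟩
    have h4 : ∑ a, (l a : ℝ) = 0 := by exact_mod_cast hl
    calc ∑ a, |(l a : ℝ)| ≤ ∑ a, ((l a : ℝ) + 2 * (-l c : ℝ)) := Finset.sum_le_sum fun a _ => h1 a
      _ = _ := by
        rw [Finset.sum_add_distrib, h4, Finset.sum_const, Finset.card_univ, nsmul_eq_mul]; ring
  have herr : ε * (1 + ∑ a, |(l a : ℝ)|) ≤ 3 / 100 * (-l c : ℝ) := by
    have h3 : (l c : ℝ) ≤ -1 := by exact_mod_cast hcneg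
    have h5 : 1 + ∑ a, |(l a : ℝ)| ≤ 3 * Fintype.card ι * (-l c : ℝ) := by nlinarith
    calc _ ≤ ε * (3 * Fintype.card ι * (-l c : ℝ)) := mul_le_mul_of_nonneg_left h5 hε0
      _ = 3 / 100 * (-l c : ℝ) * (ε * (100 * Fintype.card ι)) := by ring
      _ ≤ _ := mul_le_of_le_one_right (by linarith) hε
  by_cases h3 : 3 ≤ l p - l c
  -- The spread of `l` is at least 3, while the error is at most 3/100 of `-l c`, so the test on the
  -- coordinates `p` and `c` still gives 2.
  · refine two_le_devSq (a := p) (b := c) ?_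
    have h6 : (3 : ℝ) ≤ l p - l c := by exact_mod_cast h3
    have h7 : (1 : ℝ) ≤ l p := by exact_mod_cast hp
    have := hd c
    nlinarith
  · have hlp : l p = 1 := by omega
    have hlc : l c = -1 := by omega
    have hpc : p ≠ c := by rintro rfl; omega
    -- Now `l p = 1` and the minimum is `-1`. Were it attained only once, the sum would force all
    -- other entries to vanish and `l` would be a root.
    have : ∃ e, e ≠ c ∧ l e = -1 := by
      by_contra! hcon
      have hz : ∀ a, a ≠ p → a ≠ c → l a = 0 := by
        have h8 : ∀ a ∈ (Finset.univ.erase c).erase p, 0 ≤ l a := by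
          intro a ha
          have h9 := hcon a (by simp at ha; exact ha.2)
          have := hc' a
          omega
        have h10 : ∑ a ∈ (Finset.univ.erase c).erase p, l a = 0 := by
          have h11 := Finset.add_sum_erase Finset.univ l (Finset.mem_univ c)
          have h12 := Finset.add_sum_erase (Finset.univ.erase c) l
            (Finset.mem_erase.2 ⟨hpc, Finset.mem_univ p⟩)
          omega
        intro a hap hac
        exact (Finset.sum_eq_zero_iff_of_nonneg h8).1 h10 a (by simp [hap, hac])
      refine hr c (funext fun a => ?_)
      rcases eq_or_ne a p with rfl | hap
      · simp [root, hpc, hlp]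
      rcases eq_or_ne a c with rfl | hac
      · simp [root, hpc.symm, hlc]
      · simp [root, hap, hac, hz a hap hac]
    obtain ⟨e, hec, hle⟩ := this
    have hpe : p ≠ e := by rintro rfl; omega
    -- Without displacement this yields `16 / 6 > 2`, which leaves room for the error.
    have h13 := sq_two_mul_sub_le (fun a => l a + d a) hpc hpe hec.symm
    have h14 := hd c
    have h15 := hd e
    simp only [hlp, hlc, hle] at h13 herr
    push_cast at h13 herr
    nlinarith

end Basic
-- Displacement fields, and transfer of improvability between them
section Fields

variable {ι : Type*} [Fintype ι]

/-- The position of the site `x` displaced by the field `D`. -/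
def pos (D : (ι → ℤ) → ι → ℝ) (x : ι → ℤ) : ι → ℝ := fun a => x a + D x a

/-- The displaced lattice points form a packing. -/
def IsPacking (D : (ι → ℤ) → ι → ℝ) : Prop :=
  ∀ x y : ι → ℤ, ∑ a, x a = 0 → ∑ a, y a = 0 → x ≠ y →
    2 ≤ devSq fun a => pos D x a - pos D y a

/-- In the displaced lattice, finitely many points can be replaced by one point more. -/
def Improvable (D : (ι → ℤ) → ι → ℝ) : Prop :=
  ∃ (I : Finset (ι → ℤ)) (B : Finset (ι → ℝ)), (∀ x ∈ I, ∑ a, x a = 0) ∧ B.card = I.card + 1 ∧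
    (∀ b ∈ B, ∀ b' ∈ B, b ≠ b' → 2 ≤ devSq fun a => b a - b' a) ∧
    ∀ b ∈ B, ∀ x : ι → ℤ, ∑ a, x a = 0 → x ∉ I → 2 ≤ devSq fun a => b a - pos D x a

theorem isPacking_of_sub {D : (ι → ℤ) → ι → ℝ}
    (h : ∀ x y : ι → ℤ, ∑ a, x a = 0 → ∑ a, y a = 0 → x ≠ y →
      2 ≤ devSq fun a => ((x - y) a : ℤ) + (D x a - D y a)) : IsPacking D := by
  intro x y hx hy hxy
  refine (h x y hx hy hxy).trans_eq (congrArg devSq (funext fun a => ?_))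
  simp [pos]
  ring

theorem Improvable.of_translate {D : (ι → ℤ) → ι → ℝ} {τ : ι → ℤ} (hτ : ∑ a, τ a = 0)
    (h : Improvable fun x => D (x + τ)) : Improvable D := by
  classical
  obtain ⟨I, B, hI, hcard, hB, hBI⟩ := h
  have hinj : Function.Injective fun b : ι → ℝ => b + fun a => (τ a : ℝ) := add_left_injective _
  refine ⟨I.image (· + τ), B.image (fun b => b + fun a => (τ a : ℝ)), ?_, ?_, ?_, ?_⟩
  · simp only [Finset.mem_image]
    rintro _ ⟨x, hx, rfl⟩
    simp [Finset.sum_add_distrib, hI x hx, hτ]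
  · rw [Finset.card_image_of_injective _ hinj,
      Finset.card_image_of_injective _ (add_left_injective _), hcard]
  · simp only [Finset.mem_image]
    rintro _ ⟨b, hb, rfl⟩ _ ⟨b', hb', rfl⟩ hne
    simpa using hB b hb b' hb' fun h => hne (by rw [h])
  · simp only [Finset.mem_image]
    rintro _ ⟨b, hb, rfl⟩ x hx hxI
    have h1 := hBI b hb (x - τ) (by simp [Finset.sum_sub_distrib, hx, hτ])
      fun h => hxI ⟨x - τ, h, by simp⟩
    refine h1.trans_eq (congrArg devSq (funext fun a => ?_))
    simp [pos]
    ring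

theorem Improvable.of_add_const {D : (ι → ℤ) → ι → ℝ} (κ : ι → ℝ)
    (h : Improvable fun x => D x + κ) : Improvable D := by
  classical
  obtain ⟨I, B, hI, hcard, hB, hBI⟩ := h
  refine ⟨I, B.image (fun b => b - κ), hI, ?_, ?_, ?_⟩
  · rw [Finset.card_image_of_injective _ (sub_left_injective), hcard]
  · simp only [Finset.mem_image]
    rintro _ ⟨b, hb, rfl⟩ _ ⟨b', hb', rfl⟩ hne
    simpa using hB b hb b' hb' fun h => hne (by rw [h])
  · simp only [Finset.mem_image]
    rintro _ ⟨b, hb, rfl⟩ x hx hxI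
    refine (hBI b hb x hx hxI).trans_eq (congrArg devSq (funext fun a => ?_))
    simp [pos]
    ring

/-- The changed sites join the removed ones, and those not replaced are put back at their positions
under `E`. The count is unaffected because `E` is a packing. -/
theorem Improvable.of_finite_change {D E : (ι → ℤ) → ι → ℝ} (hE : IsPacking E)
    (hfin : {x : ι → ℤ | ∑ a, x a = 0 ∧ E x ≠ D x}.Finite) (h : Improvable E) :
    Improvable D := by
  classical
  obtain ⟨I, B, hI, hcard, hB, hBI⟩ := h
  set F := hfin.toFinset with hF
  have hFmem : ∀ x, x ∈ F ↔ ∑ a, x a = 0 ∧ E x ≠ D x := fun x => by simp [hF]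
  have hpos : ∀ x ∈ F \ I, ∑ a, x a = 0 := fun x hx =>
    ((hFmem x).1 (Finset.mem_sdiff.1 hx).1).1
  have hzero : devSq (fun _ : ι => (0 : ℝ)) = 0 := by simp [devSq]
  have hdisj : Disjoint B ((F \ I).image (pos E)) := by
    rw [Finset.disjoint_left]
    intro b hb hbF
    obtain ⟨x, hx, rfl⟩ := Finset.mem_image.1 hbF
    have := hBI _ hb x (hpos x hx) (Finset.mem_sdiff.1 hx).2
    simp only [sub_self, hzero] at this
    linarith
  have hinj : Set.InjOn (pos E) (F \ I : Finset (ι → ℤ)) := by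
    intro x hx y hy hxy
    by_contra hne
    have := hE x y (hpos x hx) (hpos y hy) hne
    simp only [hxy, sub_self, hzero] at this
    linarith
  have hsd : (I ∪ F).card = I.card + (F \ I).card := by
    rw [← Finset.card_union_of_disjoint Finset.disjoint_sdiff, Finset.union_sdiff_self_eq_union]
  refine ⟨I ∪ F, B ∪ (F \ I).image (pos E), ?_, ?_, ?_, ?_⟩
  · intro x hx
    rcases Finset.mem_union.1 hx with h | h
    · exact hI x h
    · exact ((hFmem x).1 h).1
  · rw [Finset.card_union_of_disjoint hdisj, Finset.card_image_of_injOn hinj, hcard, hsd]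
    ring
  · intro b hb b' hb' hne
    rcases Finset.mem_union.1 hb with h | h <;> rcases Finset.mem_union.1 hb' with h' | h'
    · exact hB b h b' h' hne
    · obtain ⟨x, hx, rfl⟩ := Finset.mem_image.1 h'
      exact hBI b h x (hpos x hx) (Finset.mem_sdiff.1 hx).2
    · obtain ⟨x, hx, rfl⟩ := Finset.mem_image.1 h
      rw [devSq_sub_comm]
      exact hBI b' h' x (hpos x hx) (Finset.mem_sdiff.1 hx).2
    · obtain ⟨x, hx, rfl⟩ := Finset.mem_image.1 h
      obtain ⟨y, hy, rfl⟩ := Finset.mem_image.1 h'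
      exact hE x y (hpos x hx) (hpos y hy) fun h => hne (by rw [h])
  · intro b hb x hx hxI
    rw [Finset.mem_union, not_or] at hxI
    have hED : pos D x = pos E x := by
      have : E x = D x := by
        by_contra hne
        exact hxI.2 ((hFmem x).2 ⟨hx, hne⟩)
      unfold pos
      rw [this]
    rw [hED]
    rcases Finset.mem_union.1 hb with h | h
    · exact hBI b h x hx hxI.1
    · obtain ⟨y, hy, rfl⟩ := Finset.mem_image.1 h
      refine hE y x (hpos y hy) hx ?_
      rintro rfl
      exact hxI.2 (Finset.mem_sdiff.1 hy).1

/-- The new points form a bounded set. A site with a large coordinate also has a coordinate of the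
opposite sign, so under a bounded displacement it stays away from all of them. -/
theorem Improvable.exists_radius {D : (ι → ℤ) → ι → ℝ} (h : Improvable D) (K : ℝ) :
    ∃ R : ℕ, ∀ E : (ι → ℤ) → ι → ℝ,
      (∀ x : ι → ℤ, ∑ a, x a = 0 → (∀ a, |x a| ≤ R) → E x = D x) →
      (∀ x a, |E x a| ≤ K) → Improvable E := by
  obtain ⟨I, B, hI, hcard, hB, hBI⟩ := h
  obtain ⟨M, hM⟩ : ∃ M : ℝ, ∀ b ∈ B, ∀ a, |b a| ≤ M := by
    obtain ⟨M, hM⟩ := (B.image fun b => ∑ a, |b a|).bddAbove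
    refine ⟨M, fun b hb a => ?_⟩
    exact (Finset.single_le_sum (f := fun a => |b a|) (fun a _ => abs_nonneg _)
      (Finset.mem_univ a)).trans (hM (by simpa using ⟨b, hb, rfl⟩))
  obtain ⟨R, hR⟩ := exists_nat_ge (2 * M + 2 * K + 2)
  refine ⟨R, fun E hED hK => ⟨I, B, hI, hcard, hB, fun b hb x hx hxI => ?_⟩⟩
  by_cases hxR : ∀ a, |x a| ≤ R
  · have := hBI b hb x hx hxI
    simpa only [pos, hED x hx hxR] using this
  push Not at hxR
  obtain ⟨a, ha⟩ := hxR
  have hb1 := fun c => abs_le.1 (hM b hb c)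
  have hK1 := fun c => abs_le.1 (hK x c)
  rcases lt_abs.1 ha with h | h
  · obtain ⟨c, hc⟩ := exists_neg_of_sum hx (p := a) (by omega)
    refine two_le_devSq (a := c) (b := a) ?_
    have h1 : (R : ℝ) ≤ x a := by exact_mod_cast h.le
    have h2 : (x c : ℝ) ≤ -1 := by exact_mod_cast hc
    have := hb1 c; have := hb1 a; have := hK1 c; have := hK1 a
    simp only [pos]
    linarith
  · obtain ⟨c, hc⟩ := exists_neg_of_sum (l := -x) (by simpa using hx) (p := a)
      (by simp only [Pi.neg_apply]; omega)
    refine two_le_devSq (a := a) (b := c) ?_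
    have h1 : (R : ℝ) ≤ -x a := by exact_mod_cast h.le
    have h2 : -(x c : ℝ) ≤ -1 := by exact_mod_cast hc
    have := hb1 c; have := hb1 a; have := hK1 c; have := hK1 a
    simp only [pos]
    linarith

/-- If finite changes of `D` that keep the packing can produce arbitrarily large pieces of `D'`,
and `D'` can be improved, so can `D`. -/
theorem Improvable.transfer {D D' : (ι → ℤ) → ι → ℝ} (K : ℝ)
    (h : ∀ R : ℕ, ∃ (τ : ι → ℤ) (κ : ι → ℝ) (E : (ι → ℤ) → ι → ℝ), ∑ a, τ a = 0 ∧ IsPacking E ∧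
      {x : ι → ℤ | ∑ a, x a = 0 ∧ E x ≠ D (x + τ)}.Finite ∧
      (∀ x : ι → ℤ, ∑ a, x a = 0 → (∀ a, |x a| ≤ R) → E x = D' x + κ) ∧
      ∀ x a, |E x a - κ a| ≤ K) (h' : Improvable D') : Improvable D := by
  obtain ⟨R, hR⟩ := h'.exists_radius K
  obtain ⟨τ, κ, E, hτ, hE, hfin, hED, hK⟩ := h R
  have h1 : Improvable fun x => E x - κ :=
    hR _ (fun x hx hxR => by simp [hED x hx hxR]) fun x a => by simpa using hK x a
  have h2 : Improvable E := by
    refine Improvable.of_add_const (-κ) ?_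
    simpa [sub_eq_add_neg] using h1
  exact (Improvable.of_finite_change (D := fun x => D (x + τ)) hE hfin h2).of_translate hτ

open Classical in
/-- The displacement field of a gap defect: the sites in `U` are moved by `v`. -/
noncomputable def gap (U : Set (ι → ℤ)) (v : ι → ℝ) (x : ι → ℤ) : ι → ℝ := if x ∈ U then v else 0

/-- Finiteness of the sites in a box. -/
theorem finite_box (M : ℤ) : {x : ι → ℤ | ∀ a, |x a| ≤ M}.Finite := by
  classical
  refine (Set.Finite.pi' fun _ : ι => Set.finite_Icc (-M) M).subset fun x hx a => ?_
  exact abs_le.1 (hx a)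

theorem isPacking_gap {U : Set (ι → ℤ)} {v : ι → ℝ}
    (h : ∀ x y : ι → ℤ, ∑ a, x a = 0 → ∑ a, y a = 0 → x ∈ U → y ∉ U →
      2 ≤ devSq fun a => ((x - y) a : ℤ) + v a) : IsPacking (gap U v) := by
  classical
  refine isPacking_of_sub fun x y hx hy hxy => ?_
  have hs : ∑ a, (x - y) a = 0 := by simp [Finset.sum_sub_distrib, hx, hy]
  by_cases hxU : x ∈ U <;> by_cases hyU : y ∈ U
  · simpa [gap, hxU, hyU] using two_le_devSq_int hs (sub_ne_zero.2 hxy)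
  · simpa [gap, hxU, hyU] using h x y hx hy hxU hyU
  · rw [← devSq_neg]
    refine (h y x hy hx hyU hxU).trans_eq (congrArg devSq (funext fun a => ?_))
    simp [gap, hxU, hyU]
    ring
  · simpa [gap, hxU, hyU] using two_le_devSq_int hs (sub_ne_zero.2 hxy)

theorem two_le_devSq_of_inner {l : ι → ℤ} (hl : ∑ a, l a = 0) (h0 : l ≠ 0) {v : ι → ℝ}
    (h : 0 ≤ ∑ a, v a * l a) : 2 ≤ devSq fun a => l a + v a := by
  rw [devSq_add (l := fun a => (l a : ℝ)) (by exact_mod_cast hl)]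
  have h1 := two_le_devSq_int hl h0
  have h2 := devSq_nonneg v
  simp_rw [mul_comm (v _)] at h
  linarith

theorem isPacking_gap_halfSpace (v : ι → ℝ) (c : ℝ) :
    IsPacking (gap {x | c ≤ ∑ a, v a * x a} v) := by
  refine isPacking_gap fun x y hx hy hxU hyU => ?_
  have h1 : c ≤ ∑ a, v a * x a := hxU
  have h2 : ∑ a, v a * y a < c := not_le.1 hyU
  refine two_le_devSq_of_inner (by simp [Finset.sum_sub_distrib, hx, hy]) ?_ ?_
  · rw [sub_ne_zero]
    rintro rfl
    linarith
  · simp only [Pi.sub_apply, Int.cast_sub, mul_sub, Finset.sum_sub_distrib]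
    linarith

end Fields
-- From a hyperplane to a lattice layer
section Tilt

variable {ι : Type*} [Fintype ι] [DecidableEq ι]

omit [DecidableEq ι] in
theorem abs_sum_mul_le (v : ι → ℝ) (x : ι → ℤ) {R : ℝ} (hR : ∀ a, |(x a : ℝ)| ≤ R) :
    |∑ a, v a * x a| ≤ R * ∑ a, |v a| := by
  rw [Finset.mul_sum]
  refine (Finset.abs_sum_le_sum_abs _ _).trans (Finset.sum_le_sum fun a _ => ?_)
  rw [abs_mul, mul_comm]
  exact mul_le_mul_of_nonneg_right (hR a) (abs_nonneg _)

omit [DecidableEq ι] in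
/-- A nonconstant linear form is unbounded from below on the root lattice. -/
theorem exists_sum_mul_lt {v : ι → ℝ} {a b : ι} (hab : v b < v a) (M : ℝ) :
    ∃ τ : ι → ℤ, ∑ a, τ a = 0 ∧ ∑ a, v a * τ a < M := by
  classical
  obtain ⟨n, hn⟩ := exists_nat_gt (-M / (v a - v b))
  refine ⟨fun c => n * root b a c, by rw [← Finset.mul_sum, sum_root, mul_zero], ?_⟩
  have h : ∑ c, v c * ((n * root b a c : ℤ) : ℝ) = n * (v b - v a) := by
    rw [← sum_root_mul, Finset.mul_sum]
    exact Finset.sum_congr rfl fun c _ => by push_cast; ring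
  rw [h]
  rw [div_lt_iff₀ (by linarith)] at hn
  linarith

omit [DecidableEq ι] in
/-- The lattice vectors that obstruct a displacement by `v` advance in the direction of `v`. -/
theorem sum_abs_le_of_devSq_lt {v : ι → ℝ} (hv : 0 < devSq v) {m : ι → ℤ} (hm : ∑ a, m a = 0)
    (h0 : m ≠ 0) (h : devSq (fun a => (m a : ℝ) - v a) < 2) :
    ∑ a, |(m a : ℝ)| ≤ 2 * (Fintype.card ι * (2 + 2 * ∑ a, |v a|)) / devSq v *
      ∑ a, v a * m a := by
  set V := ∑ a, |v a| with hV
  have hVa : ∀ a, |v a| ≤ V := fun a =>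
    Finset.single_le_sum (f := fun a => |v a|) (fun a _ => abs_nonneg _) (Finset.mem_univ a)
  have h1 : ∀ a b, (m a : ℝ) - m b ≤ 2 + 2 * V := by
    intro a b
    have h2 := sq_sub_le (fun a => (m a : ℝ) - v a) a b
    have h3 : (m a : ℝ) - v a - (m b - v b) ≤ 2 := by nlinarith
    have := abs_le.1 (hVa a); have := abs_le.1 (hVa b)
    linarith
  obtain ⟨p, hp⟩ := exists_pos_of_ne_zero hm h0
  obtain ⟨q, hq⟩ := exists_neg_of_sum hm hp
  have hp' : (1 : ℝ) ≤ m p := by exact_mod_cast hp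
  have hq' : (m q : ℝ) ≤ -1 := by exact_mod_cast hq
  have h4 : ∑ a, |(m a : ℝ)| ≤ Fintype.card ι * (2 + 2 * V) := by
    calc ∑ a, |(m a : ℝ)| ≤ ∑ _a : ι, (2 + 2 * V) := by
          refine Finset.sum_le_sum fun a _ => abs_le.2 ⟨?_, ?_⟩
          · linarith [h1 p a]
          · linarith [h1 a q]
      _ = _ := by rw [Finset.sum_const, Finset.card_univ, nsmul_eq_mul]
  -- Expand `devSq (m - v) < 2` and use `2 ≤ devSq m`. With the uniform bound `h4` on the size of
  -- `m`, this puts `m` into a cone around `v`.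
  have h5 : devSq v ≤ 2 * ∑ a, v a * m a := by
    have h6 := devSq_add (l := fun a => (m a : ℝ)) (by exact_mod_cast hm) (fun a => -v a)
    have h7 := two_le_devSq_int hm h0
    simp only [← sub_eq_add_neg, mul_neg, Finset.sum_neg_distrib, devSq_neg] at h6
    simp_rw [mul_comm (v _)]
    linarith
  refine h4.trans ?_
  have hV0 : 0 ≤ V := Finset.sum_nonneg fun _ _ => abs_nonneg _
  rw [div_mul_eq_mul_div, le_div_iff₀ hv]
  have : 0 ≤ (Fintype.card ι : ℝ) * (2 + 2 * V) := by positivity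
  nlinarith

/-- A gap along a half-space perpendicular to the displacement can be replaced by a gap along any
lattice half-space that the displacement allows. -/
theorem Improvable.of_tilt {I : Finset ι} {v : ι → ℝ} (hI : ∀ a ∈ I, ∀ b ∉ I, v b ≤ v a)
    {a₀ b₀ : ι} (hab : v b₀ < v a₀) (c : ℝ)
    (h : Improvable (gap {x | 0 ≤ ∑ a ∈ I, x a} v)) :
    Improvable (gap {x | c ≤ ∑ a, v a * x a} v) := by
  have hv : 0 < devSq v := by nlinarith [sq_sub_le v a₀ b₀]
  set V := ∑ a, |v a| with hV
  have hVa : ∀ a, |v a| ≤ V := fun a =>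
    Finset.single_le_sum (f := fun a => |v a|) (fun a _ => abs_nonneg _) (Finset.mem_univ a)
  have hV0 : 0 ≤ V := Finset.sum_nonneg fun _ _ => abs_nonneg _
  refine h.transfer V fun R => ?_
  -- The translation moves the original half-space out of the box of radius `R`.
  obtain ⟨τ, hτ, hτc⟩ := exists_sum_mul_lt hab (c - R * V)
  set C := 2 * (Fintype.card ι * (2 + 2 * V)) / devSq v with hC
  have hC0 : 0 ≤ C := by positivity
  set c₁ := c - ∑ a, v a * τ a with hc₁
  set C₁ := Fintype.card ι * R + C * (R * V) with hC₁
  -- To the translated half-space is added the part of the lattice half-space inside a wide cone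
  -- opening in the direction of `v`. The cone contains the box, and only finitely many of its sites
  -- lie below the hyperplane.
  set U : Set (ι → ℤ) := {x | c₁ ≤ ∑ a, v a * x a ∨
    (0 ≤ ∑ a ∈ I, x a ∧ ∑ a, |(x a : ℝ)| ≤ C * ∑ a, v a * x a + C₁)} with hU
  refine ⟨τ, 0, gap U v, hτ, ?_, ?_, ?_, ?_⟩
  · refine isPacking_gap fun x y hx hy hxU hyU => ?_
    have hs : ∑ a, (x - y) a = 0 := by simp [Finset.sum_sub_distrib, hx, hy]
    have hne : x - y ≠ 0 := by
      rw [sub_ne_zero]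
      rintro rfl
      exact hyU hxU
    have hlin : ∑ a, v a * ((x - y) a : ℤ) = ∑ a, v a * x a - ∑ a, v a * y a := by
      simp [mul_sub, Finset.sum_sub_distrib]
    by_contra! hlt
    have hneg : ∑ a, v a * x a < ∑ a, v a * y a := by
      by_contra! hle
      exact absurd (two_le_devSq_of_inner hs hne (by rw [hlin]; linarith)) (not_le.2 hlt)
    rw [hU, Set.mem_ofPred_eq, not_or, not_le] at hyU
    obtain hxU | ⟨hx1, hx2⟩ := hxU
    · linarith
    refine hyU.2 ⟨?_, ?_⟩
    -- Across the layer boundary the displacement does not bring points too close, so the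
    -- obstructing `y` lies in the lattice half-space as well.
    · by_contra! hyI
      refine absurd (two_le_devSq_of_layer hs (I := I) ?_ hI) (not_le.2 hlt)
      simp only [Pi.sub_apply, Finset.sum_sub_distrib]
      omega
    -- An obstructing pair has its difference in the cone, with the same slope `C`, so the cone
    -- condition passes from `x` to `y`.
    · have h1 : devSq (fun a => ((y - x) a : ℤ) - v a) < 2 := by
        rw [← devSq_neg]
        refine lt_of_eq_of_lt (congrArg devSq (funext fun a => ?_)) hlt
        simp
        ring
      have h2 := sum_abs_le_of_devSq_lt hv (m := y - x)
        (by simp [Finset.sum_sub_distrib, hx, hy]) (by rw [← neg_sub]; exact neg_ne_zero.2 hne) h1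
      rw [← hV, ← hC] at h2
      have hlin' : ∑ a, v a * ((y - x) a : ℤ) = ∑ a, v a * y a - ∑ a, v a * x a := by
        simp [mul_sub, Finset.sum_sub_distrib]
      rw [hlin'] at h2
      have h3 : ∑ a, |(y a : ℝ)| ≤ ∑ a, |(x a : ℝ)| + ∑ a, |((y - x) a : ℝ)| := by
        rw [← Finset.sum_add_distrib]
        refine Finset.sum_le_sum fun a _ => ?_
        calc |(y a : ℝ)| = |(x a : ℝ) + (y - x) a| := by simp
          _ ≤ _ := abs_add_le _ _
      linarith
  · obtain ⟨M, hM⟩ := exists_nat_ge (C * c₁ + C₁)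
    refine (finite_box (ι := ι) M).subset ?_
    rintro x ⟨hx, hne⟩ a
    have hlin : ∑ a, v a * ((x + τ) a : ℤ) = ∑ a, v a * x a + ∑ a, v a * τ a := by
      simp [mul_add, Finset.sum_add_distrib]
    have hiff : x + τ ∈ {x : ι → ℤ | c ≤ ∑ a, v a * x a} ↔ c₁ ≤ ∑ a, v a * x a := by
      rw [Set.mem_ofPred_eq, hlin, hc₁, sub_le_iff_le_add]
    by_cases h1 : c₁ ≤ ∑ a, v a * x a
    · have hxU : x ∈ U := Or.inl h1
      exact absurd (by rw [gap, gap, if_pos hxU, if_pos (hiff.2 h1)]) hne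
    by_cases h2 : x ∈ U
    · obtain h3 | ⟨-, h3⟩ := h2
      · exact absurd h3 h1
      have h4 : |(x a : ℝ)| ≤ ∑ a, |(x a : ℝ)| := Finset.single_le_sum
        (f := fun a => |(x a : ℝ)|) (fun a _ => abs_nonneg _) (Finset.mem_univ a)
      have h5 : |(x a : ℝ)| ≤ M := by nlinarith
      exact_mod_cast h5
    · exact absurd (by rw [gap, gap, if_neg h2, if_neg (fun h => h1 (hiff.1 h))]) hne
  · intro x hx hxR
    have hxR' : ∀ a, |(x a : ℝ)| ≤ R := fun a => by exact_mod_cast hxR a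
    have h1 := abs_le.1 (abs_sum_mul_le v x hxR')
    have h2 : ∑ a, |(x a : ℝ)| ≤ Fintype.card ι * R := by
      refine (Finset.sum_le_sum fun a _ => hxR' a).trans_eq ?_
      rw [Finset.sum_const, Finset.card_univ, nsmul_eq_mul]
    have hiff : x ∈ U ↔ x ∈ {x : ι → ℤ | 0 ≤ ∑ a ∈ I, x a} := by
      constructor
      · rintro (h3 | h3)
        · exfalso
          linarith
        · exact h3.1
      · intro h3
        refine Or.inr ⟨h3, ?_⟩
        nlinarith
    by_cases hxU : x ∈ U
    · rw [gap, gap, if_pos hxU, if_pos (hiff.1 hxU), add_zero]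
    · rw [gap, gap, if_neg hxU, if_neg (fun h => hxU (hiff.2 h)), add_zero]
  · intro x a
    by_cases hxU : x ∈ U <;> simp [gap, hxU, hVa, hV0]

end Tilt
-- Nested shells with sloped boundaries
section Shells

theorem ediv_le_ediv_add {A A' W d : ℤ} (hW : 0 < W) (hd : 0 ≤ d) (h : A' ≤ A + d) :
    A' / W ≤ A / W + d := by
  calc A' / W ≤ (A + d * W) / W := Int.ediv_le_ediv hW (by nlinarith)
    _ = A / W + d := Int.add_mul_ediv_right _ _ hW.ne'

/-- Shells are bounded alternately by level sets of two functions `A` and `B`; here `a` and `b` are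
the integer parts of `A / W` and `B / W`. -/
def shellIndex (a b : ℤ) : ℤ := if Even b then a else b

/-- An even shell ends where `a` becomes odd, an odd one where `b` becomes even. Upwards `a` can
only grow and `b` only drop, so every boundary is crossed from an even shell into an odd one. -/
theorem shellIndex_up {a b a' b' : ℤ} (h1 : b ≤ a) (h2 : a ≤ b + 1) (h1' : b' ≤ a')
    (h2' : a' ≤ b' + 1) (ha : a ≤ a') (ha' : a' ≤ a + 1) (hb : b' ≤ b) (hb' : b ≤ b' + 1) :
    shellIndex a' b' = shellIndex a b ∨ (Even (shellIndex a b) ∧ Odd (shellIndex a' b') ∧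
      shellIndex a' b' ≤ shellIndex a b + 1 ∧ shellIndex a b ≤ shellIndex a' b' + 1) := by
  unfold shellIndex
  split_ifs with h h' h' <;> simp only [Int.even_iff, Int.odd_iff] at * <;> omega

theorem shellIndex_step {a b a' b' : ℤ} (h1 : b ≤ a) (h2 : a ≤ b + 1) (h1' : b' ≤ a')
    (h2' : a' ≤ b' + 1) (ha : a ≤ a') (ha' : a' ≤ a + 1) (hb : b ≤ b') (hb' : b' ≤ b + 1)
    (hab : ¬ (a = b + 1 ∧ a' = a + 1 ∧ b' = b + 1)) :
    shellIndex a b ≤ shellIndex a' b' ∧ shellIndex a' b' ≤ shellIndex a b + 1 := by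
  unfold shellIndex
  split_ifs with h h' h' <;> simp only [Int.even_iff] at * <;> omega

theorem shellIndex_mem {a b : ℤ} (h1 : b ≤ a) (h2 : a ≤ b + 1) :
    a - 1 ≤ shellIndex a b ∧ shellIndex a b ≤ a := by
  unfold shellIndex
  split_ifs <;> omega

variable {ι : Type*} [Fintype ι] [DecidableEq ι] [Nonempty ι]

/-- The height of a site above the bottom of the slab `-h ≤ ∑ a ∈ I, x a < h`. -/
def height (I : Finset ι) (h : ℤ) (x : ι → ℤ) : ℤ := ∑ a ∈ I, x a + h

/-- The coordinate `x c`, with the sign that makes it weakly increase upwards. -/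
def signedCoord (I : Finset ι) (x : ι → ℤ) (c : ι) : ℤ := if c ∈ I then x c else -x c

/-- A norm-like function that weakly increases upwards, by less than the height. -/
def reach (I : Finset ι) (h : ℤ) (x : ι → ℤ) : ℤ :=
  2 * h + Finset.univ.sup' Finset.univ_nonempty fun c =>
    max (signedCoord I x c) (height I h x - signedCoord I x c)

/-- The index of the shell around the center that contains `x`. -/
def shell (I : Finset ι) (h W : ℤ) (x : ι → ℤ) : ℤ :=
  shellIndex (reach I h x / W) ((reach I h x - height I h x) / W)

variable {I : Finset ι} {h W : ℤ} {x y : ι → ℤ}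

theorem reach_le_add {d : ℤ}
    (hd : ∀ c, max (signedCoord I x c) (height I h x - signedCoord I x c) ≤
      max (signedCoord I y c) (height I h y - signedCoord I y c) + d) :
    reach I h x ≤ reach I h y + d := by
  have : Finset.univ.sup' Finset.univ_nonempty (fun c =>
      max (signedCoord I x c) (height I h x - signedCoord I x c)) ≤
      Finset.univ.sup' Finset.univ_nonempty (fun c =>
        max (signedCoord I y c) (height I h y - signedCoord I y c)) + d := by
    refine Finset.sup'_le _ _ fun c hc => (hd c).trans ?_
    have := Finset.le_sup' (fun c => max (signedCoord I y c) (height I h y - signedCoord I y c)) hc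
    exact add_le_add_left this d
  unfold reach
  linarith

theorem le_reach (c : ι) :
    2 * h + max (signedCoord I x c) (height I h x - signedCoord I x c) ≤ reach I h x :=
  add_le_add_right (Finset.le_sup' (fun c =>
    max (signedCoord I x c) (height I h x - signedCoord I x c)) (Finset.mem_univ c)) _

theorem reach_le {M : ℤ}
    (hM : ∀ c, max (signedCoord I x c) (height I h x - signedCoord I x c) ≤ M) :
    reach I h x ≤ 2 * h + M :=
  add_le_add_right (Finset.sup'_le _ _ fun c _ => hM c) _

omit [Fintype ι] [Nonempty ι] in
theorem height_add_root (a b : ι) : height I h (y + root a b) =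
    height I h y + (if a ∈ I then 1 else 0) - (if b ∈ I then 1 else 0) := by
  simp only [height, Pi.add_apply, Finset.sum_add_distrib, root, Pi.sub_apply,
    Finset.sum_sub_distrib, Finset.sum_pi_single']
  ring

omit [Fintype ι] [Nonempty ι] in
theorem signedCoord_add_root (a b c : ι) : signedCoord I (y + root a b) c = signedCoord I y c +
    (if c ∈ I then 1 else -1) * ((if c = a then 1 else 0) - (if c = b then 1 else 0)) := by
  simp only [signedCoord, Pi.add_apply, root, Pi.sub_apply, Pi.single_apply]
  split_ifs <;> ring

/-- Upwards the height grows by 1 and each signed coordinate by 0 or 1, hence so does height minus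
signed coordinate. Thus `reach` weakly increases while `reach - height` weakly decreases, as the
shells require. -/
theorem reach_root_up {a b : ι} (ha : a ∈ I) (hb : b ∉ I) :
    reach I h y ≤ reach I h (y + root a b) ∧ reach I h (y + root a b) ≤ reach I h y + 1 := by
  have hab : a ≠ b := fun h => hb (h ▸ ha)
  have key : ∀ c, signedCoord I (y + root a b) c = signedCoord I y c ∨
      signedCoord I (y + root a b) c = signedCoord I y c + 1 := by
    intro c
    rw [signedCoord_add_root]
    rcases eq_or_ne c a with rfl | hca
    · simp [ha, hab]
    rcases eq_or_ne c b with rfl | hcb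
    · simp [hb, hca]
    · simp [hca, hcb]
  have hh : height I h (y + root a b) = height I h y + 1 := by simp [height_add_root, ha, hb]
  constructor
  · have := reach_le_add (I := I) (h := h) (x := y) (y := y + root a b) (d := 0) fun c => by
      rcases key c with h | h <;> omega
    omega
  · exact reach_le_add fun c => by rcases key c with h | h <;> omega

theorem reach_root_layer {a b : ι} (hab : a ∈ I ↔ b ∈ I) :
    reach I h (y + root a b) ≤ reach I h y + 1 := by
  refine reach_le_add fun c => ?_
  have hh : height I h (y + root a b) = height I h y := by simp [height_add_root, hab]
  have h1 := signedCoord_add_root (I := I) (y := y) a b c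
  rw [hh, h1]
  split_ifs <;> omega

omit [DecidableEq ι] [Nonempty ι] in
theorem abs_le_sum_abs (l : ι → ℤ) (c : ι) : |l c| ≤ ∑ a, |l a| :=
  Finset.single_le_sum (f := fun a => |l a|) (fun _ _ => abs_nonneg _) (Finset.mem_univ c)

theorem reach_le_add_sum : reach I h x ≤ reach I h y + 2 * ∑ a, |(x - y) a| := by
  refine reach_le_add fun c => ?_
  have h1 : -(∑ a, |(x - y) a|) ≤ x c - y c ∧ x c - y c ≤ ∑ a, |(x - y) a| :=
    abs_le.1 (abs_le_sum_abs (x - y) c)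
  have h2 : |height I h x - height I h y| ≤ ∑ a, |(x - y) a| := by
    have : height I h x - height I h y = ∑ a ∈ I, (x - y) a := by
      simp [height, Finset.sum_sub_distrib]
    rw [this]
    exact (Finset.abs_sum_le_sum_abs _ _).trans
      (Finset.sum_le_sum_of_subset_of_nonneg (Finset.subset_univ I) fun _ _ _ => abs_nonneg _)
  have h3 := abs_le.1 h2
  unfold signedCoord
  split_ifs <;> omega

section Slab

variable (hx0 : 0 ≤ height I h x) (hxW : height I h x < W)
  (hy0 : 0 ≤ height I h y) (hyW : height I h y < W)

include hx0 hxW in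
theorem ediv_reach : (reach I h x - height I h x) / W ≤ reach I h x / W ∧
    reach I h x / W ≤ (reach I h x - height I h x) / W + 1 := by
  have hW : 0 < W := by omega
  refine ⟨Int.ediv_le_ediv hW (by omega), ?_⟩
  calc reach I h x / W ≤ (reach I h x - height I h x + 1 * W) / W :=
        Int.ediv_le_ediv hW (by omega)
    _ = _ := Int.add_mul_ediv_right _ _ hW.ne'

include hx0 hxW hy0 hyW in
theorem shell_root_up {a b : ι} (ha : a ∈ I) (hb : b ∉ I) (hxy : x = y + root a b) :
    shell I h W x = shell I h W y ∨ (Even (shell I h W y) ∧ Odd (shell I h W x) ∧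
      shell I h W x ≤ shell I h W y + 1 ∧ shell I h W y ≤ shell I h W x + 1) := by
  have hW : 0 < W := by omega
  obtain ⟨h1, h2⟩ := reach_root_up (h := h) (y := y) ha hb
  have hh : height I h x = height I h y + 1 := by simp [hxy, height_add_root, ha, hb]
  rw [← hxy] at h1 h2
  obtain ⟨h3, h4⟩ := ediv_reach hx0 hxW
  obtain ⟨h5, h6⟩ := ediv_reach hy0 hyW
  exact shellIndex_up h5 h6 h3 h4 (Int.ediv_le_ediv hW h1)
    (ediv_le_ediv_add hW zero_le_one h2) (Int.ediv_le_ediv hW (by omega))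
    (ediv_le_ediv_add hW zero_le_one (by omega))

include hx0 hxW hy0 hyW in
theorem shell_le_of_reach_le (hh : height I h x = height I h y) (h1 : reach I h y ≤ reach I h x)
    (h2 : reach I h x ≤ reach I h y + 1) :
    shell I h W y ≤ shell I h W x ∧ shell I h W x ≤ shell I h W y + 1 := by
  have hW : 0 < W := by omega
  obtain ⟨h3, h4⟩ := ediv_reach hx0 hxW
  obtain ⟨h5, h6⟩ := ediv_reach hy0 hyW
  refine shellIndex_step h5 h6 h3 h4 (Int.ediv_le_ediv hW h1)
    (ediv_le_ediv_add hW zero_le_one h2) (Int.ediv_le_ediv hW (by omega))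
    (ediv_le_ediv_add hW zero_le_one (by omega)) ?_
  -- If `reach` and `reach - height` passed multiples of `W` in the same unit step, their
  -- difference, the height, would be `W`, contrary to `height < W`.
  rintro ⟨e1, e2, e3⟩
  have f1 := Int.ediv_mul_le (reach I h x) hW.ne'
  have f2 := Int.ediv_mul_le (reach I h x - height I h x) hW.ne'
  have f3 := Int.lt_ediv_add_one_mul_self (reach I h y) hW
  have f4 := Int.lt_ediv_add_one_mul_self (reach I h y - height I h y) hW
  rw [e2, e1] at f1
  rw [e3] at f2
  rw [e1] at f3
  rw [add_mul, add_mul] at f1 f3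
  rw [add_mul] at f2 f4
  omega

include hx0 hxW hy0 hyW in
theorem shell_root_layer {a b : ι} (hab : a ∈ I ↔ b ∈ I) (hxy : x = y + root a b) :
    shell I h W x ≤ shell I h W y + 1 ∧ shell I h W y ≤ shell I h W x + 1 := by
  have hh : height I h x = height I h y := by simp [hxy, height_add_root, hab]
  have h1 := reach_root_layer (h := h) (y := y) hab
  have h2 := reach_root_layer (h := h) (y := x) hab.symm
  have hyx : x + root b a = y := by
    rw [hxy, add_assoc]
    simp [root]
  rw [← hxy] at h1
  rw [hyx] at h2
  rcases le_total (reach I h y) (reach I h x) with hle | hle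
  · have := shell_le_of_reach_le hx0 hxW hy0 hyW hh hle h1
    omega
  · have := shell_le_of_reach_le hy0 hyW hx0 hxW hh.symm hle h2
    omega

include hx0 hxW hy0 hyW in
theorem shell_le_add_sum : shell I h W x ≤ shell I h W y + (2 * ∑ a, |(x - y) a| + 1) := by
  have hW : 0 < W := by omega
  have h0 : 0 ≤ ∑ a, |(x - y) a| := Finset.sum_nonneg fun _ _ => abs_nonneg _
  obtain ⟨h3, h4⟩ := ediv_reach hx0 hxW
  obtain ⟨h5, h6⟩ := ediv_reach hy0 hyW
  have h7 := ediv_le_ediv_add hW (by omega) (reach_le_add_sum (I := I) (h := h) (x := x) (y := y))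
  have h8 := shellIndex_mem h3 h4
  have h9 := shellIndex_mem h5 h6
  unfold shell
  omega

include hx0 hxW in
-- The summand `2 * h` in `reach` serves this purpose: it keeps `reach - height` nonnegative in the
-- slab.
theorem shell_nonneg (hh : height I h x < 2 * h) : 0 ≤ shell I h W x := by
  have hW : 0 < W := by omega
  obtain ⟨c⟩ := ‹Nonempty ι›
  have h1 := le_reach (I := I) (h := h) (x := x) c
  have h2 : 0 ≤ (reach I h x - height I h x) / W := Int.ediv_nonneg (by omega) hW.le
  have h3 := (ediv_reach hx0 hxW).1
  unfold shell shellIndex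
  split_ifs <;> omega

include hx0 hxW in
theorem abs_le_of_shell_lt {N : ℤ} (hh : height I h x < 2 * h) (hN : shell I h W x < N) (c : ι) :
    |x c| ≤ (N + 1) * W := by
  have hW : 0 < W := by omega
  obtain ⟨h3, h4⟩ := ediv_reach hx0 hxW
  have h5 := shellIndex_mem h3 h4
  have h6 := Int.lt_ediv_add_one_mul_self (reach I h x) hW
  have h7 : (reach I h x / W + 1) * W ≤ (N + 1) * W :=
    mul_le_mul_of_nonneg_right (by unfold shell at hN; omega) hW.le
  have h8 := le_reach (I := I) (h := h) (x := x) c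
  unfold signedCoord at h8
  rw [abs_le]
  split_ifs at h8 <;> omega

include hx0 hxW in
theorem shell_eq_zero {R : ℤ} (hh : height I h x < 2 * h) (hR : ∀ a, |x a| ≤ R)
    (hW : 4 * h + R < W) : shell I h W x = 0 := by
  have hm : reach I h x ≤ 2 * h + (2 * h + R) := reach_le fun c => by
    have := abs_le.1 (hR c)
    unfold signedCoord
    split_ifs <;> omega
  have h1 : reach I h x / W ≤ 0 := by
    have := (Int.ediv_lt_iff_lt_mul (a := reach I h x) (b := 1) (c := W) (by omega)).2 (by omega)
    omega
  have h2 := shell_nonneg hx0 hxW hh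
  obtain ⟨h3, h4⟩ := ediv_reach hx0 hxW
  have h5 := shellIndex_mem h3 h4
  unfold shell at *
  omega

end Slab
end Shells
-- The displacement in the slab keeps spheres apart
section Slab

/-- The factor by which displacements are scaled down in the shell with index `m`. -/
noncomputable def fade (η : ℝ) (m : ℤ) : ℝ := max 0 (1 - η * m)

/-- The extra height of the shell with index `m`. -/
noncomputable def lift (α : ℝ) (n m : ℤ) : ℝ := if Odd m ∧ m < n then 2 * α else 0

theorem fade_nonneg (η : ℝ) (m : ℤ) : 0 ≤ fade η m := le_max_left _ _

theorem fade_le_one {η : ℝ} (hη : 0 ≤ η) {m : ℤ} (hm : 0 ≤ m) : fade η m ≤ 1 := by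
  have : (0 : ℝ) ≤ m := by exact_mod_cast hm
  exact max_le zero_le_one (by nlinarith)

theorem fade_eq_zero {η : ℝ} {n m : ℤ} (hη : 0 ≤ η) (hn : 1 ≤ η * n) (hm : n ≤ m) :
    fade η m = 0 := by
  have : (n : ℝ) ≤ m := by exact_mod_cast hm
  exact max_eq_left (by nlinarith)

theorem abs_fade_sub_le {η : ℝ} (hη : 0 ≤ η) (m m' : ℤ) :
    |fade η m - fade η m'| ≤ η * |(m : ℝ) - m'| := by
  unfold fade
  rw [max_comm 0, max_comm 0]
  refine (abs_max_sub_max_le_abs _ _ _).trans_eq ?_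
  rw [show 1 - η * m - (1 - η * m') = η * (m' - m) by ring, abs_mul, abs_of_nonneg hη, abs_sub_comm]

theorem lift_nonneg {α : ℝ} (hα : 0 ≤ α) (n m : ℤ) : 0 ≤ lift α n m := by
  unfold lift
  split_ifs <;> linarith

theorem lift_le {α : ℝ} (hα : 0 ≤ α) (n m : ℤ) : lift α n m ≤ 2 * α := by
  unfold lift
  split_ifs <;> linarith

theorem lift_of_even {α : ℝ} {n m : ℤ} (h : Even m) : lift α n m = 0 :=
  if_neg fun h' => (Int.not_odd_iff_even.2 h) h'.1

theorem lift_of_le {α : ℝ} {n m : ℤ} (h : n ≤ m) : lift α n m = 0 :=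
  if_neg fun h' => (not_lt.2 h) h'.2

theorem lift_of_odd {α : ℝ} {n m : ℤ} (h : Odd m) (h' : m < n) : lift α n m = 2 * α :=
  if_pos ⟨h, h'⟩

variable {ι : Type*} [Fintype ι] [DecidableEq ι] [Nonempty ι]

/-- The displacement of a site in the slab: `R` or `L`, according to the side of the crack, scaled
down in the outer shells, with the shells of odd index raised. -/
noncomputable def slabField (I : Finset ι) (h W n : ℤ) (η α : ℝ) (p : ι) (L R : ι → ℝ)
    (x : ι → ℤ) (a : ι) : ℝ :=
  fade η (shell I h W x) * (if 0 ≤ x p then R a else L a) +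
    if a ∈ I then lift α n (shell I h W x) else 0

omit [Nonempty ι] in
theorem two_le_devSq_root_add {a b : ι} (hab : a ≠ b) {d : ι → ℝ}
    (h : 0 ≤ 2 * (d a - d b) + devSq d) : 2 ≤ devSq fun c => (root a b c : ℝ) + d c := by
  rw [devSq_add (l := fun c => (root a b c : ℝ)) (by exact_mod_cast sum_root a b), devSq_root hab,
    sum_root_mul]
  linarith

variable {I : Finset ι} {h W n : ℤ} {η α K : ℝ} {p q : ι} {L R : ι → ℝ}

section Pairs

variable (hp : p ∈ I) (hη : 0 ≤ η) (hα : 0 ≤ α) (hn : Even n) (hηn : 1 ≤ η * n)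
  (hLI : ∀ a ∈ I, ∀ b ∉ I, L b ≤ L a) (hRI : ∀ a ∈ I, ∀ b ∉ I, R b ≤ R a)
  (hRp : ∀ b ∈ I, R b ≤ R p) (hLp : ∀ b ∈ I, L p ≤ L b) (hLR : ∀ c ∉ I, L p - L c ≤ R p - R c)
  (hLK : ∀ a b, |L a - L b| ≤ K) (hRK : ∀ a b, |R a - R b| ≤ K)
  {x y : ι → ℤ} (hx0 : 0 ≤ height I h x) (hxW : height I h x < W)
  (hy0 : 0 ≤ height I h y) (hyW : height I h y < W)

include hp hη hn hηn hLI hRI hLR hLK hRK hx0 hxW hy0 hyW in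
-- Neighbours in adjacent layers: inside one shell the shifts do not approach each other, and at a
-- boundary the upper neighbour is raised by `2 * α`, which outweighs the fading loss `η * K`.
theorem two_le_devSq_slab_up (hκ : η * K ≤ 2 * α) {a b : ι} (ha : a ∈ I) (hb : b ∉ I)
    (hxy : x - y = root a b) :
    2 ≤ devSq fun c => ((x - y) c : ℤ) +
      (slabField I h W n η α p L R x c - slabField I h W n η α p L R y c) := by
  have hab : a ≠ b := fun h => hb (h ▸ ha)
  have hxy' : x = y + root a b := by rw [← hxy]; abel
  have hpb : p ≠ b := fun h => hb (h ▸ hp)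
  rw [hxy]
  refine two_le_devSq_root_add hab ?_
  refine add_nonneg (mul_nonneg zero_le_two ?_) (devSq_nonneg _)
  set X : ι → ℝ := fun c => if 0 ≤ x p then R c else L c with hX
  set Y : ι → ℝ := fun c => if 0 ≤ y p then R c else L c with hY
  have hYX : Y a - Y b ≤ X a - X b := by
    have h1 : x p = y p + if p = a then 1 else 0 := by
      simp [hxy', root, hpb, Pi.single_apply]
    simp only [hX, hY]
    by_cases hpa : p = a
    · subst hpa
      have h2 := hLR b hb
      rw [if_pos rfl] at h1
      split_ifs <;> linarith
    · rw [if_neg hpa, add_zero] at h1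
      rw [h1]
  have hY0 : 0 ≤ Y a - Y b := by
    simp only [hY]
    split_ifs
    · linarith [hRI a ha b hb]
    · linarith [hLI a ha b hb]
  have hYK : Y a - Y b ≤ K := by
    simp only [hY]
    split_ifs
    · exact (le_abs_self _).trans (hRK a b)
    · exact (le_abs_self _).trans (hLK a b)
  set m := shell I h W x
  set m' := shell I h W y
  have hd : slabField I h W n η α p L R x a - slabField I h W n η α p L R y a -
      (slabField I h W n η α p L R x b - slabField I h W n η α p L R y b) =
      fade η m * (X a - X b) - fade η m' * (Y a - Y b) + (lift α n m - lift α n m') := by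
    simp only [slabField, ha, hb, if_true, if_false, hX, hY]
    ring
  rw [hd]
  have hf := fade_nonneg η m
  rcases shell_root_up hx0 hxW hy0 hyW ha hb hxy' with hm | ⟨he, ho, hm1, hm2⟩
  · change m = m' at hm
    rw [hm] at hf ⊢
    nlinarith
  · change Even m' at he
    change Odd m at ho
    rw [lift_of_even he]
    rcases lt_or_ge m n with hmn | hmn
    · rw [lift_of_odd ho hmn]
      have h1 := abs_fade_sub_le hη m m'
      have h2 : |(m : ℝ) - m'| ≤ 1 := by
        have : |m - m'| ≤ 1 := abs_le.2 ⟨by omega, by omega⟩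
        exact_mod_cast this
      have h3 : -η ≤ fade η m - fade η m' := by
        have := (abs_le.1 h1).1
        nlinarith
      nlinarith
    -- Since `n` is even and `m` is odd, `n ≤ m` forces `n < m`, so the adjacent shell is also
    -- beyond the fading and nothing moves.
    · have h4 : n ≤ m' := by
        rcases ho with ⟨r, hr⟩
        rcases hn with ⟨s, hs⟩
        omega
      rw [fade_eq_zero hη hηn hmn, fade_eq_zero hη hηn h4, lift_of_le hmn]
      simp

include hp hη hn hηn hRp hLp hLK hRK hx0 hxW hy0 hyW in
-- Neighbours in one layer: fading costs at most `2 * (η * K)`. At a shell boundary the raise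
-- changes the difference of the coordinates `p` and `q` by at least `2 * α - η * K ≥ α`, so the
-- quadratic term is at least `α ^ 2 / 2`, which covers the cost.
theorem two_le_devSq_slab_layer (hq : q ∉ I) (hκ : η * K ≤ α) (hκ' : 4 * (η * K) ≤ α ^ 2)
    {a b : ι} (hne : a ≠ b) (hab : a ∈ I ↔ b ∈ I) (hxy : x - y = root a b) :
    2 ≤ devSq fun c => ((x - y) c : ℤ) +
      (slabField I h W n η α p L R x c - slabField I h W n η α p L R y c) := by
  have hxy' : x = y + root a b := by rw [← hxy]; abel
  rw [hxy]
  refine two_le_devSq_root_add hne ?_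
  set m := shell I h W x with hm
  set m' := shell I h W y with hm'
  have hf := fade_nonneg η m
  have hf' := fade_nonneg η m'
  have hxp : x p = y p + ((if p = a then 1 else 0) - (if p = b then 1 else 0)) := by
    simp [hxy', root, Pi.single_apply]
  have hd0 : ∀ a b : ι, (a ∈ I ↔ b ∈ I) →
      slabField I h W n η α p L R x a - slabField I h W n η α p L R y a -
      (slabField I h W n η α p L R x b - slabField I h W n η α p L R y b) =
      fade η m * ((if 0 ≤ x p then R a else L a) - (if 0 ≤ x p then R b else L b)) -
      fade η m' * ((if 0 ≤ y p then R a else L a) - (if 0 ≤ y p then R b else L b)) := by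
    intro a b hab
    simp only [slabField, hab]
    ring
  by_cases hside : 0 ≤ x p ↔ 0 ≤ y p
  · set X : ι → ℝ := fun c => if 0 ≤ x p then R c else L c with hX
    have hXK : ∀ a b, |X a - X b| ≤ K := by
      intro a b
      simp only [hX]
      split_ifs
      · exact hRK a b
      · exact hLK a b
    have hK0 : 0 ≤ K := (abs_nonneg _).trans (hLK p p)
    have hda := hd0 a b hab
    have hdp : slabField I h W n η α p L R x p - slabField I h W n η α p L R y p -
        (slabField I h W n η α p L R x q - slabField I h W n η α p L R y q) =
        (fade η m - fade η m') * (X p - X q) + (lift α n m - lift α n m') := by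
      simp only [slabField, hp, hq, if_true, if_false, hX, ← hside]
      ring
    have hda' : slabField I h W n η α p L R x a - slabField I h W n η α p L R y a -
        (slabField I h W n η α p L R x b - slabField I h W n η α p L R y b) =
        (fade η m - fade η m') * (X a - X b) := by
      rw [hda]
      simp only [hX, ← hside]
      ring
    rw [hda']
    obtain ⟨hm1, hm2⟩ := shell_root_layer hx0 hxW hy0 hyW hab hxy'
    rw [← hm, ← hm'] at hm1 hm2
    have h1 := abs_fade_sub_le hη m m'
    have h2 : |(m : ℝ) - m'| ≤ 1 := by
      have : |m - m'| ≤ 1 := abs_le.2 ⟨by omega, by omega⟩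
      exact_mod_cast this
    have h3 : |fade η m - fade η m'| ≤ η := h1.trans (mul_le_of_le_one_right hη h2)
    have h4 : ∀ a b, |(fade η m - fade η m') * (X a - X b)| ≤ η * K := by
      intro a b
      rw [abs_mul]
      exact mul_le_mul h3 (hXK a b) (abs_nonneg _) hη
    have hsq := sq_sub_le (fun c =>
      slabField I h W n η α p L R x c - slabField I h W n η α p L R y c) p q
    simp only [hdp] at hsq
    have h5 := abs_le.1 (h4 a b)
    have h6 := abs_le.1 (h4 p q)
    have hdev := devSq_nonneg (fun c =>
      slabField I h W n η α p L R x c - slabField I h W n η α p L R y c)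
    have hηK : 0 ≤ η * K := mul_nonneg hη hK0
    rcases eq_or_ne m m' with he | he
    · rw [he, sub_self, zero_mul]
      linarith
    · by_cases hbig : n ≤ m ∧ n ≤ m'
      · rw [fade_eq_zero hη hηn hbig.1, fade_eq_zero hη hηn hbig.2, sub_self, zero_mul]
        linarith
      · rcases Int.even_or_odd m with hpar | hpar
        · have hpar' : Odd m' := by
            rcases hpar with ⟨r, hr⟩
            exact ⟨(m' - 1) / 2, by omega⟩
          have hlt : m' < n := by
            rcases hpar' with ⟨r, hr⟩
            rcases hn with ⟨s, hs⟩
            omega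
          rw [lift_of_even hpar, lift_of_odd hpar' hlt] at hsq
          nlinarith
        · have hpar' : Even m' := by
            rcases hpar with ⟨r, hr⟩
            exact ⟨m' / 2, by omega⟩
          have hlt : m < n := by
            rcases hpar with ⟨r, hr⟩
            rcases hn with ⟨s, hs⟩
            omega
          rw [lift_of_even hpar', lift_of_odd hpar hlt] at hsq
          nlinarith
  -- Across the crack the shifts on both sides point away from it. Each contributes with a
  -- nonnegative fading factor, so the shells need not be compared.
  · refine add_nonneg (mul_nonneg zero_le_two ?_) (devSq_nonneg _)
    rw [hd0 a b hab]
    by_cases hpa : p = a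
    · subst hpa
      have hpb : p ≠ b := hne
      have h1 := hRp b (hab.1 hp)
      have h2 := hLp b (hab.1 hp)
      rw [if_pos rfl, if_neg hpb] at hxp
      rw [if_pos (by omega), if_pos (by omega), if_neg (by omega), if_neg (by omega)]
      nlinarith
    · by_cases hpb : p = b
      · subst hpb
        have h1 := hRp a (hab.2 hp)
        have h2 := hLp a (hab.2 hp)
        rw [if_pos rfl, if_neg hpa] at hxp
        rw [if_neg (by omega), if_neg (by omega), if_pos (by omega), if_pos (by omega)]
        nlinarith
      · rw [if_neg hpa, if_neg hpb] at hxp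
        exact absurd (by rw [hxp]; simp) hside

include hp hη hα hRp hLp hLR hLK hRK hx0 hxW hy0 hyW in
-- Pairs that are not neighbours have slack. The fading difference grows at most linearly with the
-- distance, as `two_le_devSq_of_not_root` permits.
theorem two_le_devSq_slab_of_not_root (hx : ∑ a, x a = 0) (hy : ∑ a, y a = 0) (hxy : x ≠ y)
    (hr : ∀ a b, x - y ≠ root a b) (hside : 0 ≤ y p → 0 ≤ x p)
    (hε : (2 * (η * K) + 2 * α) * (100 * Fintype.card ι) ≤ 1) :
    2 ≤ devSq fun c => ((x - y) c : ℤ) +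
      (slabField I h W n η α p L R x c - slabField I h W n η α p L R y c) := by
  have hs : ∑ a, (x - y) a = 0 := by simp [Finset.sum_sub_distrib, hx, hy]
  have hK0 : 0 ≤ K := (abs_nonneg _).trans (hLK p p)
  set m := shell I h W x with hm
  set m' := shell I h W y with hm'
  have hf := fade_nonneg η m
  have hf' := fade_nonneg η m'
  set S : ℝ := ∑ a, |((x - y) a : ℝ)| with hS
  have hS0 : 0 ≤ S := Finset.sum_nonneg fun _ _ => abs_nonneg _
  have hmm : |(m : ℝ) - m'| ≤ 2 * S + 1 := by
    have h1 := shell_le_add_sum hx0 hxW hy0 hyW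
    have h2 := shell_le_add_sum hy0 hyW hx0 hxW
    have h3 : ∑ a, |(y - x) a| = ∑ a, |(x - y) a| :=
      Finset.sum_congr rfl fun a _ => abs_sub_comm _ _
    rw [h3] at h2
    have h4 : |m - m'| ≤ 2 * ∑ a, |(x - y) a| + 1 := abs_le.2 ⟨by omega, by omega⟩
    rw [hS]
    exact_mod_cast h4
  have hfade : |fade η m - fade η m'| ≤ η * (2 * S + 1) :=
    (abs_fade_sub_le hη m m').trans (mul_le_mul_of_nonneg_left hmm hη)
  have hl := lift_nonneg hα n m
  have hl' := lift_nonneg hα n m'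
  have hu := lift_le hα n m
  have hu' := lift_le hα n m'
  have hηK : 0 ≤ η * K := mul_nonneg hη hK0
  have hprod : ∀ t : ℝ, |t| ≤ K →
      -((2 * (η * K) + 2 * α) * (1 + S)) + 2 * α ≤ (fade η m - fade η m') * t := by
    intro t ht
    have h1 : |(fade η m - fade η m') * t| ≤ η * (2 * S + 1) * K := by
      rw [abs_mul]
      exact mul_le_mul hfade ht (abs_nonneg _) (by positivity)
    have h2 := (abs_le.1 h1).1
    nlinarith [mul_nonneg hα hS0, mul_nonneg hηK hS0]
  have hneg : -((2 * (η * K) + 2 * α) * (1 + S)) ≤ 0 := by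
    have : 0 ≤ (2 * (η * K) + 2 * α) * (1 + S) := by positivity
    linarith
  -- The jump from `L` to `R` is not small, but it favours the coordinate `p`; for a pair across the
  -- crack `p` is therefore the positive coordinate to test.
  by_cases hcross : 0 ≤ x p ∧ y p < 0
  · refine two_le_devSq_of_not_root hs (p := p) (by simp only [Pi.sub_apply]; omega)
      (fun b => hr p b) (by positivity) hε fun c => ?_
    have h1 := hprod (L p - L c) (hLK p c)
    rw [← hS]
    simp only [slabField, if_pos hcross.1, if_neg (not_le.2 hcross.2), if_pos hp, ← hm, ← hm']
    by_cases hc : c ∈ I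
    · have h2 := hRp c hc
      have h3 := hLp c hc
      rw [if_pos hc, if_pos hc]
      nlinarith
    · have h2 := hLR c hc
      rw [if_neg hc, if_neg hc]
      nlinarith
  · have hiff : 0 ≤ x p ↔ 0 ≤ y p := by
      refine ⟨fun h => ?_, hside⟩
      by_contra h'
      exact hcross ⟨h, not_le.1 h'⟩
    obtain ⟨r, hrr⟩ := exists_pos_of_ne_zero hs (sub_ne_zero.2 hxy)
    refine two_le_devSq_of_not_root hs hrr (fun b => hr r b) (by positivity) hε fun c => ?_
    have h1 := hprod ((if 0 ≤ x p then R r else L r) - (if 0 ≤ x p then R c else L c)) (by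
      split_ifs
      · exact hRK r c
      · exact hLK r c)
    rw [← hS]
    simp only [slabField, ← hiff, ← hm, ← hm']
    generalize (if 0 ≤ x p then R r else L r) = u at *
    generalize (if 0 ≤ x p then R c else L c) = w at *
    split_ifs <;> nlinarith

include hp hη hα hn hηn hLI hRI hRp hLp hLR hLK hRK hx0 hxW hy0 hyW in
theorem two_le_devSq_slab (hq : q ∉ I) (hκ : η * K ≤ α) (hκ' : 4 * (η * K) ≤ α ^ 2)
    (hε : (2 * (η * K) + 2 * α) * (100 * Fintype.card ι) ≤ 1)
    (hx : ∑ a, x a = 0) (hy : ∑ a, y a = 0) (hxy : x ≠ y) :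
    2 ≤ devSq fun c => ((x - y) c : ℤ) +
      (slabField I h W n η α p L R x c - slabField I h W n η α p L R y c) := by
  have hswap : ∀ D : (ι → ℤ) → ι → ℝ, devSq (fun c => ((y - x) c : ℤ) + (D y c - D x c)) =
      devSq (fun c => ((x - y) c : ℤ) + (D x c - D y c)) := by
    intro D
    rw [← devSq_neg]
    refine congrArg devSq (funext fun a => ?_)
    simp
    ring
  by_cases hr : ∃ a b, x - y = root a b
  · obtain ⟨a, b, hab⟩ := hr
    have hne : a ≠ b := by
      rintro rfl
      exact sub_ne_zero.2 hxy (by simp [hab, root])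
    have hba : y - x = root b a := by
      rw [← neg_sub, hab]
      simp [root]
    by_cases ha : a ∈ I <;> by_cases hb : b ∈ I
    · exact two_le_devSq_slab_layer hp hη hn hηn hRp hLp hLK hRK hx0 hxW hy0 hyW hq hκ hκ' hne
        (iff_of_true ha hb) hab
    · exact two_le_devSq_slab_up hp hη hn hηn hLI hRI hLR hLK hRK hx0 hxW hy0 hyW
        (by linarith) ha hb hab
    · rw [← hswap]
      exact two_le_devSq_slab_up hp hη hn hηn hLI hRI hLR hLK hRK hy0 hyW hx0 hxW
        (by linarith) hb ha hba
    · exact two_le_devSq_slab_layer hp hη hn hηn hRp hLp hLK hRK hx0 hxW hy0 hyW hq hκ hκ' hne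
        (iff_of_false ha hb) hab
  · push Not at hr
    by_cases hside : 0 ≤ y p → 0 ≤ x p
    · exact two_le_devSq_slab_of_not_root hp hη hα hRp hLp hLR hLK hRK hx0 hxW hy0 hyW hx hy hxy
        hr hside hε
    · rw [← hswap]
      refine two_le_devSq_slab_of_not_root hp hη hα hRp hLp hLR hLK hRK hy0 hyW hx0 hxW hy hx
        hxy.symm (fun a b hab => hr b a ?_) (fun h => by omega) hε
      rw [← neg_sub, hab]
      simp [root]

end Pairs

end Slab
-- Cracks, widening and the induction
section Step

variable {ι : Type*} [Fintype ι] [DecidableEq ι] [Nonempty ι]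

/-- The packing with a gap defect in which the gap has been closed in a slab below the gap, except
for a crack in the middle of the slab and thin cracks between the shells around the center. -/
noncomputable def crackField (I : Finset ι) (h W n : ℤ) (η α : ℝ) (p : ι) (L R v : ι → ℝ)
    (x : ι → ℤ) : ι → ℝ :=
  if height I h x < 0 then 0 else
    if height I h x < 2 * h then slabField I h W n η α p L R x else v

omit [DecidableEq ι] [Nonempty ι] in
theorem isPacking_of_le (f : (ι → ℤ) → ℤ) {D : (ι → ℤ) → ι → ℝ}
    (h : ∀ x y : ι → ℤ, ∑ a, x a = 0 → ∑ a, y a = 0 → x ≠ y → f y ≤ f x →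
      2 ≤ devSq fun a => ((x - y) a : ℤ) + (D x a - D y a)) : IsPacking D := by
  refine isPacking_of_sub fun x y hx hy hxy => ?_
  rcases le_total (f y) (f x) with hle | hle
  · exact h x y hx hy hxy hle
  · rw [← devSq_neg]
    refine (h y x hy hx hxy.symm hle).trans_eq (congrArg devSq (funext fun a => ?_))
    simp
    ring

variable {I : Finset ι} {h W n : ℤ} {η α K : ℝ} {p q : ι} {L R v : ι → ℝ}

theorem isPacking_crackField (hp : p ∈ I) (hq : q ∉ I) (hη : 0 ≤ η) (hα : 0 ≤ α) (hn : Even n)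
    (hηn : 1 ≤ η * n) (hW : 2 * h ≤ W)
    (hL : ∀ a ∈ I, ∀ b ∉ I, L b ≤ L a ∧ L a - L b + 2 * α ≤ v a - v b)
    (hR : ∀ a ∈ I, ∀ b ∉ I, R b ≤ R a ∧ R a - R b + 2 * α ≤ v a - v b)
    (hRp : ∀ b ∈ I, R b ≤ R p) (hLp : ∀ b ∈ I, L p ≤ L b) (hLR : ∀ c ∉ I, L p - L c ≤ R p - R c)
    (hLK : ∀ a b, |L a - L b| ≤ K) (hRK : ∀ a b, |R a - R b| ≤ K)
    (hκ : η * K ≤ α) (hκ' : 4 * (η * K) ≤ α ^ 2)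
    (hε : (2 * (η * K) + 2 * α) * (100 * Fintype.card ι) ≤ 1) :
    IsPacking (crackField I h W n η α p L R v) := by
  -- In the directions across layers the slab moves by an amount between 0, as below it, and `v`, as
  -- above it. This handles both faces of the slab.
  have hslab : ∀ z : ι → ℤ, 0 ≤ height I h z → height I h z < 2 * h → ∀ a ∈ I, ∀ b ∉ I,
      slabField I h W n η α p L R z b ≤ slabField I h W n η α p L R z a ∧
      slabField I h W n η α p L R z a - slabField I h W n η α p L R z b ≤ v a - v b := by
    intro z hz0 hz1 a ha b hb
    have h1 := fade_nonneg η (shell I h W z)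
    have h2 := fade_le_one hη (shell_nonneg hz0 (hz1.trans_le hW) hz1)
    have h3 := lift_nonneg hα n (shell I h W z)
    have h4 := lift_le hα n (shell I h W z)
    have h5 := hL a ha b hb
    have h6 := hR a ha b hb
    simp only [slabField, if_pos ha, if_neg hb]
    split_ifs <;> constructor <;> nlinarith
  refine isPacking_of_le (height I h) fun x y hx hy hxy hle => ?_
  have hs : ∑ a, (x - y) a = 0 := by simp [Finset.sum_sub_distrib, hx, hy]
  have hsI : ∑ a ∈ I, (x - y) a = height I h x - height I h y := by
    simp [height, Finset.sum_sub_distrib]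
  have hne := two_le_devSq_int hs (sub_ne_zero.2 hxy)
  unfold crackField
  by_cases hx0 : height I h x < 0
  · have hy0 : height I h y < 0 := by omega
    simpa [hx0, hy0] using hne
  by_cases hx1 : height I h x < 2 * h
  · have hy1 : height I h y < 2 * h := by omega
    by_cases hy0 : height I h y < 0
    · simp only [hx0, hx1, hy0, if_true, if_false, Pi.zero_apply, sub_zero]
      exact two_le_devSq_of_layer hs (I := I) (by omega) fun a ha b hb =>
        (hslab x (not_lt.1 hx0) hx1 a ha b hb).1
    · simp only [hx0, hx1, hy0, hy1, if_true, if_false]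
      exact two_le_devSq_slab hp hη hα hn hηn (fun a ha b hb => (hL a ha b hb).1)
        (fun a ha b hb => (hR a ha b hb).1) hRp hLp hLR hLK hRK (not_lt.1 hx0) (by omega)
        (not_lt.1 hy0) (by omega) hq hκ hκ' hε hx hy hxy
  by_cases hy0 : height I h y < 0
  · simp only [hx0, hx1, hy0, if_true, if_false, Pi.zero_apply, sub_zero]
    refine two_le_devSq_of_layer hs (I := I) (by omega) fun a ha b hb => ?_
    linarith [(hL a ha b hb).1, (hL a ha b hb).2]
  by_cases hy1 : height I h y < 2 * h
  · simp only [hx0, hx1, hy0, hy1, if_true, if_false]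
    refine two_le_devSq_of_layer hs (I := I) (by omega) fun a ha b hb => ?_
    linarith [(hslab y (not_lt.1 hy0) hy1 a ha b hb).2]
  · simpa [hx0, hx1, hy0, hy1] using hne

/-- If opening a crack along the coordinate `p` improves the packing, so does the gap from which
the crack can be fed. -/
theorem Improvable.of_crack (hp : p ∈ I) (hq : q ∉ I) (hα : 0 < α)
    (hL : ∀ a ∈ I, ∀ b ∉ I, L b ≤ L a ∧ L a - L b + 2 * α ≤ v a - v b)
    (hR : ∀ a ∈ I, ∀ b ∉ I, R b ≤ R a ∧ R a - R b + 2 * α ≤ v a - v b)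
    (hRp : ∀ b ∈ I, R b ≤ R p) (hLp : ∀ b ∈ I, L p ≤ L b) (hLR : ∀ c ∉ I, L p - L c ≤ R p - R c)
    (c : ℤ) (himp : Improvable (gap {x | 1 ≤ ∑ a ∈ Finset.univ.erase p, x a} (L - R))) :
    Improvable (gap {x | c ≤ ∑ a ∈ I, x a} v) := by
  set β : ℝ := min (min α 1) (1 / (400 * Fintype.card ι)) with hβ
  have hN : (1 : ℝ) ≤ Fintype.card ι := by exact_mod_cast Fintype.card_pos
  have hβ0 : 0 < β := lt_min (lt_min hα one_pos) (by positivity)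
  have hβα : β ≤ α := (min_le_left _ _).trans (min_le_left _ _)
  have hβ1 : β ≤ 1 := (min_le_left _ _).trans (min_le_right _ _)
  have hβN : β * (400 * Fintype.card ι) ≤ 1 := by
    have : β ≤ 1 / (400 * Fintype.card ι) := min_le_right _ _
    rwa [le_div_iff₀ (by positivity)] at this
  set V := ∑ a, |v a| with hV
  set SL := ∑ a, |L a| with hSL
  set SR := ∑ a, |R a| with hSR
  have hVa : ∀ a, |v a| ≤ V := fun a =>
    Finset.single_le_sum (f := fun a => |v a|) (fun a _ => abs_nonneg _) (Finset.mem_univ a)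
  have hLa : ∀ a, |L a| ≤ SL := fun a =>
    Finset.single_le_sum (f := fun a => |L a|) (fun a _ => abs_nonneg _) (Finset.mem_univ a)
  have hRa : ∀ a, |R a| ≤ SR := fun a =>
    Finset.single_le_sum (f := fun a => |R a|) (fun a _ => abs_nonneg _) (Finset.mem_univ a)
  have hV0 : 0 ≤ V := Finset.sum_nonneg fun _ _ => abs_nonneg _
  have hSL0 : 0 ≤ SL := Finset.sum_nonneg fun _ _ => abs_nonneg _
  have hSR0 : 0 ≤ SR := Finset.sum_nonneg fun _ _ => abs_nonneg _
  set K := 2 * (SL + SR) + 1 with hK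
  have hK0 : 0 < K := by positivity
  have hLK : ∀ a b, |L a - L b| ≤ K := fun a b => (abs_sub _ _).trans (by
    linarith [hLa a, hLa b])
  have hRK : ∀ a b, |R a - R b| ≤ K := fun a b => (abs_sub _ _).trans (by
    linarith [hRa a, hRa b])
  set η := β ^ 2 / (4 * K) with hη
  have hη0 : 0 < η := by positivity
  have hηK : 4 * (η * K) = β ^ 2 := by
    rw [hη]
    field_simp
  have hκ : η * K ≤ β := by nlinarith
  have hε : (2 * (η * K) + 2 * β) * (100 * Fintype.card ι) ≤ 1 := by nlinarith
  obtain ⟨n₀, hn₀⟩ := exists_nat_ge (1 / η)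
  set n : ℤ := 2 * n₀ with hn
  have hηn : 1 ≤ η * n := by
    rw [div_le_iff₀ hη0] at hn₀
    rw [hn]
    push_cast
    nlinarith
  refine himp.transfer (V + SL + 2 * SR + 2 * β) fun r => ?_
  -- The box of radius `r` fits into the slab, and `W` below is large enough for it to lie in shell
  -- 0, where nothing is faded or raised.
  set h : ℤ := Fintype.card ι * r + 1 with hh
  have hh0 : 0 ≤ (Fintype.card ι * r : ℤ) := by positivity
  set W : ℤ := 4 * h + r + 1 with hW
  -- The translation places the gap at height `2 * h`, the top of the slab. Up to the constant `R`,
  -- the side `0 ≤ x p` of the crack is at rest and the other side moves by `L - R`.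
  refine ⟨fun a => (c - h) * root p q a, R, crackField I h W n η β p L R v, ?_, ?_, ?_, ?_, ?_⟩
  · rw [← Finset.mul_sum, sum_root, mul_zero]
  · exact isPacking_crackField hp hq hη0.le hβ0.le ⟨n₀, by omega⟩ hηn (by omega)
      (fun a ha b hb => ⟨(hL a ha b hb).1, by linarith [(hL a ha b hb).2]⟩)
      (fun a ha b hb => ⟨(hR a ha b hb).1, by linarith [(hR a ha b hb).2]⟩)
      hRp hLp hLR hLK hRK hκ hηK.le hε
  · refine (finite_box (ι := ι) ((n + 1) * W)).subset ?_
    rintro x ⟨hx, hne⟩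
    have hroot : ∑ a ∈ I, root p q a = 1 := by
      simp [root, Finset.sum_sub_distrib, hp, hq]
    have hiff : (x + fun a => (c - h) * root p q a) ∈ {x : ι → ℤ | c ≤ ∑ a ∈ I, x a} ↔
        2 * h ≤ height I h x := by
      rw [Set.mem_ofPred_eq]
      simp only [Pi.add_apply, Finset.sum_add_distrib, ← Finset.mul_sum, hroot, height]
      omega
    by_cases hx0 : height I h x < 0
    · rw [crackField, if_pos hx0, gap, if_neg (by rw [hiff]; omega)] at hne
      exact absurd rfl hne
    by_cases hx1 : height I h x < 2 * h
    · rw [crackField, if_neg hx0, if_pos hx1, gap, if_neg (by rw [hiff]; omega)] at hne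
      refine abs_le_of_shell_lt (I := I) (h := h) (not_lt.1 hx0) (by omega) hx1 ?_
      by_contra! hle
      refine hne (funext fun a => ?_)
      rw [slabField, fade_eq_zero hη0.le hηn hle, lift_of_le hle]
      simp
    · rw [crackField, if_neg hx0, if_neg hx1, gap, if_pos (by rw [hiff]; omega)] at hne
      exact absurd rfl hne
  · intro x hx hxr
    have h1 : |∑ a ∈ I, x a| ≤ Fintype.card ι * r := by
      calc |∑ a ∈ I, x a| ≤ ∑ a ∈ I, |x a| := Finset.abs_sum_le_sum_abs _ _
        _ ≤ ∑ a, |x a| := Finset.sum_le_sum_of_subset_of_nonneg (Finset.subset_univ I)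
          fun _ _ _ => abs_nonneg _
        _ ≤ ∑ _a : ι, (r : ℤ) := Finset.sum_le_sum fun a _ => hxr a
        _ = _ := by rw [Finset.sum_const, Finset.card_univ, nsmul_eq_mul]
    have h2 := abs_le.1 h1
    have hx0 : 0 ≤ height I h x := by unfold height; omega
    have hx1 : height I h x < 2 * h := by unfold height; omega
    have hz := shell_eq_zero hx0 (W := W) (by omega) hx1 hxr (by omega)
    have h3 : ∑ a ∈ Finset.univ.erase p, x a = -x p := by
      have := Finset.add_sum_erase Finset.univ x (Finset.mem_univ p)
      omega
    have hiff : x ∈ {x : ι → ℤ | 1 ≤ ∑ a ∈ Finset.univ.erase p, x a} ↔ ¬ 0 ≤ x p := by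
      rw [Set.mem_ofPred_eq, h3]
      omega
    rw [crackField, if_neg (by omega), if_pos hx1]
    funext a
    rw [slabField, hz, lift_of_even (by simp)]
    by_cases hxp : 0 ≤ x p
    · have hg : gap {x : ι → ℤ | 1 ≤ ∑ a ∈ Finset.univ.erase p, x a} (L - R) x = 0 :=
        if_neg fun h => hiff.1 h hxp
      rw [Pi.add_apply, hg]
      simp [fade, hxp]
    · have hg : gap {x : ι → ℤ | 1 ≤ ∑ a ∈ Finset.univ.erase p, x a} (L - R) x = L - R :=
        if_pos (hiff.2 hxp)
      rw [Pi.add_apply, hg]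
      simp [fade, hxp]
  · intro x a
    have hv := abs_le.1 (hVa a)
    have hl := abs_le.1 (hLa a)
    have hr := abs_le.1 (hRa a)
    unfold crackField
    split_ifs with hx0 hx1
    · simp only [Pi.zero_apply]
      exact abs_le.2 ⟨by linarith, by linarith⟩
    · have f0 := fade_nonneg η (shell I h W x)
      have f1 := fade_le_one hη0.le (shell_nonneg (not_lt.1 hx0) (W := W) (by omega) hx1)
      have l0 := lift_nonneg hβ0.le n (shell I h W x)
      have l1 := lift_le hβ0.le n (shell I h W x)
      have hu : |if 0 ≤ x p then R a else L a| ≤ SL + SR := by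
        split_ifs
        · linarith [hRa a]
        · linarith [hLa a]
      have hfu : |fade η (shell I h W x) * if 0 ≤ x p then R a else L a| ≤ SL + SR := by
        rw [abs_mul, abs_of_nonneg f0]
        exact (mul_le_of_le_one_left (abs_nonneg _) f1).trans hu
      have hfu' := abs_le.1 hfu
      unfold slabField
      refine abs_le.2 ?_
      by_cases ha : a ∈ I
      · rw [if_pos ha]
        constructor <;> linarith
      · rw [if_neg ha]
        constructor <;> linarith
    · exact abs_le.2 ⟨by linarith, by linarith⟩

omit [Nonempty ι] in
/-- In a very wide gap there is room for one point more. -/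
theorem improvable_of_wide {o : ι} (ho : ∃ a, a ≠ o) (hv : ∀ a, a ≠ o → 4 ≤ v a - v o) (c : ℤ) :
    Improvable (gap {x | c ≤ ∑ a ∈ Finset.univ.erase o, x a} v) := by
  obtain ⟨a₀, ha₀⟩ := ho
  have hne : (Finset.univ.erase o).Nonempty := ⟨a₀, by simp [ha₀]⟩
  have hsum : ∀ x : ι → ℤ, ∑ a, x a = 0 → ∑ a ∈ Finset.univ.erase o, x a = -x o := by
    intro x hx
    have := Finset.add_sum_erase Finset.univ x (Finset.mem_univ o)
    omega
  have key : ∀ l : ι → ℤ, ∑ a, l a = 0 → l o ≤ 0 → ∃ a, a ≠ o ∧ 0 ≤ l a - l o := by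
    intro l hl hlo
    obtain ⟨a, ha, hla⟩ := exists_nonneg_of_sum hne (l := l) (by rw [hsum l hl]; omega)
    exact ⟨a, (Finset.mem_erase.1 ha).1, by omega⟩
  set x₀ : ι → ℤ := fun a => c * root a₀ o a with hx₀
  have hx₀s : ∑ a, x₀ a = 0 := by rw [hx₀, ← Finset.mul_sum, sum_root, mul_zero]
  have hx₀o : x₀ o = -c := by simp [hx₀, root, ha₀.symm]
  -- The new point lies over a site of the lowest moved layer, halfway across the gap, so each side
  -- is left with a difference of at least 2.
  refine ⟨∅, {fun a => x₀ a + v a / 2}, by simp, by simp, by simp, ?_⟩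
  intro b hb x hx _
  rw [Finset.mem_singleton] at hb
  subst hb
  by_cases hxU : x ∈ {x : ι → ℤ | c ≤ ∑ a ∈ Finset.univ.erase o, x a}
  · obtain ⟨a, hao, ha⟩ := key (x - x₀) (by simp [Finset.sum_sub_distrib, hx, hx₀s]) (by
      rw [Set.mem_ofPred_eq, hsum x hx] at hxU
      simp only [Pi.sub_apply, hx₀o]
      omega)
    rw [devSq_sub_comm]
    refine two_le_devSq (a := a) (b := o) ?_
    have h1 := hv a hao
    have h2 : (0 : ℝ) ≤ x a - x₀ a - (x o - x₀ o) := by exact_mod_cast ha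
    simp only [pos, gap, if_pos hxU]
    linarith
  · obtain ⟨a, hao, ha⟩ := key (x₀ - x) (by simp [Finset.sum_sub_distrib, hx, hx₀s]) (by
      rw [Set.mem_ofPred_eq, hsum x hx] at hxU
      simp only [Pi.sub_apply, hx₀o]
      omega)
    refine two_le_devSq (a := a) (b := o) ?_
    have h1 := hv a hao
    have h2 : (0 : ℝ) ≤ x₀ a - x a - (x₀ o - x o) := by exact_mod_cast ha
    simp only [pos, gap, if_neg hxU, Pi.zero_apply]
    linarith

/-- One step of widening: the crack is fed along the coordinate `p`. -/
theorem Improvable.of_widen {o : ι} (hpo : p ≠ o) (hα : 0 < α)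
    (hv : ∀ a, a ≠ o → 2 * α ≤ v a - v o) (c : ℤ)
    (himp : ∀ w : ι → ℝ, w o - w p = v p - v o - 2 * α →
      (∀ a, a ≠ o → a ≠ p → w a - w p = v p - v o + (v a - v o) - 4 * α) →
      Improvable (gap {x | 1 ≤ ∑ a ∈ Finset.univ.erase p, x a} w)) :
    Improvable (gap {x | c ≤ ∑ a ∈ Finset.univ.erase o, x a} v) := by
  have hp := hv p hpo
  -- The room `v a - v o`, less `2 * α` for the raise, is spent on `p` alone on one side of the
  -- crack and on all other coordinates of the layer on the other side. In `L - R` the two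
  -- contributions add up, except towards `o`.
  refine Improvable.of_crack (I := Finset.univ.erase o) (p := p) (q := o) (α := α)
    (L := fun a => if a = p ∨ a = o then 0 else v a - v o - 2 * α)
    (R := fun a => if a = p then v p - v o - 2 * α else 0)
    (by simp [hpo]) (by simp) hα ?_ ?_ ?_ ?_ ?_ c (himp _ ?_ ?_)
  · intro a ha b hb
    obtain rfl : b = o := by simpa using hb
    have hab : a ≠ b := by simpa using ha
    have := hv a hab
    rcases eq_or_ne a p with rfl | hap
    · simp
      linarith
    · simp [hap, hab]
      linarith
  · intro a ha b hb
    obtain rfl : b = o := by simpa using hb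
    have hab : a ≠ b := by simpa using ha
    have := hv a hab
    rcases eq_or_ne a p with rfl | hap
    · simp [hpo.symm]
      linarith
    · simp [hap, hpo.symm]
      linarith
  · intro b hb
    simp only [if_true]
    split_ifs <;> linarith
  · intro b hb
    have := hv b (by simpa using hb)
    simp only [true_or, if_true]
    split_ifs <;> linarith
  · intro b hb
    obtain rfl : b = o := by simpa using hb
    simp [hpo.symm]
    linarith
  · simp [hpo.symm]
  · intro a hao hap
    simp [hao, hap]
    ring

/-- A gap along a layer of the root lattice can be improved, in dimension at least two. -/
theorem improvable_layer (hcard : 3 ≤ Fintype.card ι) (k : ℕ) : ∀ (s : ℝ) (o : ι) (v : ι → ℝ)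
    (c : ℤ), 0 < s → 4 ≤ s * (3 / 2) ^ k → (∀ a, a ≠ o → s ≤ v a - v o) →
    Improvable (gap {x | c ≤ ∑ a ∈ Finset.univ.erase o, x a} v) := by
  have hex : ∀ a b : ι, ∃ c, c ≠ a ∧ c ≠ b := by
    intro a b
    by_contra! hc
    have : (Finset.univ : Finset ι) ⊆ {a, b} := fun c _ => by
      by_cases h : c = a
      · simp [h]
      · simp [hc c h]
    have h2 := (Finset.card_le_card this).trans Finset.card_le_two
    rw [Finset.card_univ] at h2
    omega
  induction k with
  | zero =>
    intro s o v c hs hsk hv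
    obtain ⟨a, ha, -⟩ := hex o o
    exact improvable_of_wide ⟨a, ha⟩ (fun a ha => by linarith [hv a ha]) c
  | succ k ih =>
    intro s o v c hs hsk hv
    obtain ⟨p, hpo, -⟩ := hex o o
    refine Improvable.of_widen (α := s / 20) hpo (by linarith)
      (fun a ha => by linarith [hv a ha]) c fun w hw1 hw2 => ?_
    obtain ⟨r, hro, hrp⟩ := hex o p
    have hp := hv p hpo
    have hr := hv r hro
    have hwr := hw2 r hro hrp
    have hw : ∀ a, a ≠ p → s / 2 ≤ w a - w p := by
      intro a hap
      rcases eq_or_ne a o with rfl | hao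
      · linarith
      · linarith [hw2 a hao hap, hv a hao]
    -- The first step leaves at least `0.9 * s` towards `o` and `1.8 * s` towards the others.
    -- Feeding along `r`, one of the wide coordinates, gives at least `1.7 * s` towards `p` and `2.5
    -- * s` towards the rest, so the factor 3/2 is safe.
    refine Improvable.of_widen (α := s / 20) hrp (by linarith)
      (fun a ha => by linarith [hw a ha]) 1 fun u hu1 hu2 => ?_
    refine ih (3 / 2 * s) r u 1 (by linarith) (by rw [pow_succ] at hsk; linarith) fun a har => ?_
    rcases eq_or_ne a p with rfl | hap
    · linarith
    have h3 := hu2 a hap har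
    rcases eq_or_ne a o with rfl | hao
    · linarith
    · linarith [hw2 a hao hap, hv a hao]

/-- A gap defect of the root lattice, in dimension at least two, along a hyperplane perpendicular
to the displacement can be improved. -/
theorem improvable_gap (hcard : 3 ≤ Fintype.card ι) {a₀ b₀ : ι} (hab : v b₀ < v a₀) (c : ℝ) :
    Improvable (gap {x | c ≤ ∑ a, v a * x a} v) := by
  obtain ⟨p, -, hpmax⟩ := Finset.exists_max_image Finset.univ v ⟨a₀, Finset.mem_univ _⟩
  have hpmax' : ∀ a, v a ≤ v p := fun a => hpmax a (Finset.mem_univ a)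
  -- With the maximal coordinates as `I`, the displacement opens the layer gap by at least `δ > 0`
  -- in every direction across it.
  set I : Finset ι := {a | v a = v p} with hI
  have hIc : (Finset.univ \ I).Nonempty :=
    ⟨b₀, by simpa [hI] using (hab.trans_le (hpmax' a₀)).ne⟩
  obtain ⟨q, hq, hqmax⟩ := Finset.exists_max_image (Finset.univ \ I) v hIc
  have hqI : q ∉ I := (Finset.mem_sdiff.1 hq).2
  have hqp : v q < v p := lt_of_le_of_ne (hpmax' q) (by simpa [hI] using hqI)
  have hpI : p ∈ I := by simp [hI]
  set δ := v p - v q with hδ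
  have hδ0 : 0 < δ := by linarith
  have hvI : ∀ a ∈ I, ∀ b ∉ I, δ ≤ v a - v b := by
    intro a ha b hb
    have h1 : v a = v p := by simpa [hI] using ha
    have h2 := hqmax b (by simpa using hb)
    linarith
  refine Improvable.of_tilt (I := I) (fun a ha b hb => by linarith [hvI a ha b hb]) hab c ?_
  -- A first crack passes from the general set `I` to the complement of a single coordinate, as
  -- `improvable_layer` requires: `L - R` is smallest at `p`, by at least `δ / 2`.
  refine Improvable.of_crack (p := p) (q := q) (α := δ / 4)
    (L := fun a => if a ∈ I ∧ a ≠ p then δ / 2 else 0)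
    (R := fun a => if a = p then δ / 2 else 0) hpI hqI (by linarith) ?_ ?_ ?_ ?_ ?_ 0 ?_
  · intro a ha b hb
    have := hvI a ha b hb
    simp only [ha, hb, true_and, false_and, if_false]
    split_ifs <;> constructor <;> linarith
  · intro a ha b hb
    have := hvI a ha b hb
    have hbp : b ≠ p := fun h => hb (h ▸ hpI)
    simp only [hbp, if_false]
    split_ifs <;> constructor <;> linarith
  · intro b _
    simp only [if_true]
    split_ifs <;> linarith
  · intro b _
    simp only [ne_eq, not_true_eq_false, and_false, if_false]
    split_ifs <;> linarith
  · intro b hb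
    have hbp : b ≠ p := fun h => hb (h ▸ hpI)
    simp [hb, hbp]
    linarith
  · obtain ⟨k, hk⟩ := pow_unbounded_of_one_lt (4 / (δ / 2)) (show (1 : ℝ) < 3 / 2 by norm_num)
    refine improvable_layer hcard k (δ / 2) p _ 1 (by linarith) ?_ ?_
    · rw [div_lt_iff₀ (by linarith)] at hk
      linarith
    · intro a hap
      simp only [Pi.sub_apply, ne_eq, not_true_eq_false, and_false, if_false, if_true, hap]
      split_ifs <;> linarith

end Step
-- Back to sphere packings; honeycomb and fcc as root lattices
section SpherePackings

variable {ι : Type*} [Fintype ι] {n : ℕ}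

theorem not_isCompletelySaturated_of_improvable {S : SpherePacking n}
    {Φ : (ι → ℝ) → EuclideanSpace ℝ (Fin n)}
    (hΦ : ∀ y z, dist (Φ y) (Φ z) ^ 2 = 2 * devSq fun a => y a - z a) {D : (ι → ℤ) → ι → ℝ}
    (hS : S.centers = {w | ∃ x : ι → ℤ, ∑ a, x a = 0 ∧ w = Φ (pos D x)}) (hD : IsPacking D)
    (h : Improvable D) : ¬ S.IsCompletelySaturated := by
  classical
  obtain ⟨I, B, hI, hcard, hB, hBI⟩ := h
  have hdist : ∀ y z, 2 ≤ devSq (fun a => y a - z a) → 2 ≤ dist (Φ y) (Φ z) := by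
    intro y z hyz
    nlinarith [hΦ y z, dist_nonneg (x := Φ y) (y := Φ z)]
  have hne : ∀ y z, 2 ≤ devSq (fun a => y a - z a) → Φ y ≠ Φ z := by
    intro y z hyz heq
    have := hdist y z hyz
    rw [heq, dist_self] at this
    linarith
  set A : Finset (EuclideanSpace ℝ (Fin n)) := I.image fun x => Φ (pos D x) with hA
  have hmem : ∀ w ∈ S.centers \ A, ∃ x : ι → ℤ, ∑ a, x a = 0 ∧ x ∉ I ∧ w = Φ (pos D x) := by
    rintro w ⟨hw, hwA⟩
    rw [hS] at hw
    obtain ⟨x, hx, rfl⟩ := hw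
    exact ⟨x, hx, fun hxI => hwA (by simpa [hA] using ⟨x, hxI, rfl⟩), rfl⟩
  intro hsat
  refine hsat (I.card + 1) (by omega) ⟨A, B.image Φ, ?_, ?_, ?_, ?_, ?_⟩
  · intro w hw
    obtain ⟨x, hx, rfl⟩ := Finset.mem_image.1 (Finset.mem_coe.1 hw)
    rw [hS]
    exact ⟨x, hI x hx, rfl⟩
  · rw [Finset.card_image_of_injOn]
    intro x hx y hy hxy
    by_contra hxy'
    exact hne _ _ (hD x y (hI x hx) (hI y hy) hxy') hxy
  · rw [Finset.card_image_of_injOn, hcard]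
    intro b hb b' hb' hbb
    by_contra hbb'
    exact hne _ _ (hB b hb b' hb' hbb') hbb
  · rw [Set.disjoint_left]
    intro w hw hw'
    obtain ⟨b, hb, rfl⟩ := Finset.mem_image.1 (Finset.mem_coe.1 hw)
    obtain ⟨x, hx, hxI, heq⟩ := hmem _ hw'
    exact hne _ _ (hBI b hb x hx hxI) heq
  · refine ⟨⟨(S.centers \ A) ∪ (B.image Φ : Finset _), ?_⟩, rfl⟩
    rintro y (hy | hy) z (hz | hz) hyz
    · exact S.separated y hy.1 z hz.1 hyz
    · obtain ⟨b, hb, rfl⟩ := Finset.mem_image.1 (Finset.mem_coe.1 hz)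
      obtain ⟨x, hx, hxI, rfl⟩ := hmem _ hy
      rw [dist_comm]
      exact hdist _ _ (hBI b hb x hx hxI)
    · obtain ⟨b, hb, rfl⟩ := Finset.mem_image.1 (Finset.mem_coe.1 hy)
      obtain ⟨x, hx, hxI, rfl⟩ := hmem _ hz
      exact hdist _ _ (hBI b hb x hx hxI)
    · obtain ⟨b, hb, rfl⟩ := Finset.mem_image.1 (Finset.mem_coe.1 hy)
      obtain ⟨b', hb', rfl⟩ := Finset.mem_image.1 (Finset.mem_coe.1 hz)
      exact hdist _ _ (hB b hb b' hb' fun h => hyz (by rw [h]))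

/-- Polarization of `hL`; since `l` has sum zero, the mean of `v` drops out. -/
theorem inner_map_eq {L : (ι → ℝ) →ₗ[ℝ] EuclideanSpace ℝ (Fin n)}
    (hL : ∀ z, ‖L z‖ ^ 2 = 2 * devSq z) (v : ι → ℝ) {l : ι → ℝ} (hl : ∑ a, l a = 0) :
    inner ℝ (L v) (L l) = 2 * ∑ a, v a * l a := by
  have h1 := norm_add_sq_real (L l) (L v)
  have h2 := devSq_add hl v
  rw [← map_add, hL, hL, hL] at h1
  change 2 * devSq (fun a => l a + v a) = _ at h1
  rw [real_inner_comm]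
  simp_rw [mul_comm (v _)]
  linarith

/-- A packing congruent to a root lattice `Aₙ`, `n ≥ 2`, with a gap defect is not completely
saturated. -/
theorem not_isCompletelySaturated_gapDefect (hcard : 3 ≤ Fintype.card ι)
    {L : (ι → ℝ) →ₗ[ℝ] EuclideanSpace ℝ (Fin n)} (hL : ∀ z, ‖L z‖ ^ 2 = 2 * devSq z)
    (hsurj : Function.Surjective L) {S₀ S : SpherePacking n}
    (hS₀ : S₀.centers = {w | ∃ x : ι → ℤ, ∑ a, x a = 0 ∧ w = L fun a => (x a : ℝ)})
    (hS : S₀.IsCongruent S) {v : EuclideanSpace ℝ (Fin n)} (hv : v ≠ 0) (c : ℝ) :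
    ¬ (S.gapDefect v c).IsCompletelySaturated := by
  classical
  have : Nonempty ι := Fintype.card_pos_iff.1 (by omega)
  obtain ⟨e, he⟩ := hS
  -- By Mazur–Ulam the congruence is affine; `f` is its linear part.
  set f := e.toRealAffineIsometryEquiv.linearIsometryEquiv with hf
  have hef : ∀ p u, e (p + u) = e p + f u := by
    intro p u
    have := e.toRealAffineIsometryEquiv.map_vadd p u
    rw [vadd_eq_add, vadd_eq_add] at this
    rw [add_comm p u]
    exact this.trans (add_comm _ _)
  obtain ⟨u, hu⟩ := hsurj (f.symm v)
  have hfu : f (L u) = v := by rw [hu, LinearIsometryEquiv.apply_symm_apply]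
  obtain ⟨a, b, hab⟩ : ∃ a b, u b < u a := by
    by_contra! hc
    obtain ⟨a₀⟩ := ‹Nonempty ι›
    have hconst : ∀ a, u a = u a₀ := fun a => le_antisymm (hc a a₀) (hc a₀ a)
    have h0 : devSq u = 0 := by
      have : (Fintype.card ι : ℝ) ≠ 0 := by exact_mod_cast Fintype.card_ne_zero
      simp only [devSq, hconst, Finset.sum_const, Finset.card_univ, nsmul_eq_mul]
      field_simp
      ring
    have h1 := hL u
    rw [h0, mul_zero, sq_eq_zero_iff, norm_eq_zero] at h1
    exact hv (by rw [← hfu, h1, map_zero])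
  -- The threshold in lattice coordinates: `e 0` is the image of the origin, and the factor 2 comes
  -- from `inner_map_eq`.
  set c' := (c - inner ℝ v (e 0)) / 2 with hc'
  have hinner : ∀ x : ι → ℤ, ∑ a, x a = 0 →
      (c ≤ inner ℝ v (e (L fun a => (x a : ℝ))) ↔ c' ≤ ∑ a, u a * x a) := by
    intro x hx
    have h1 : e (L fun a => (x a : ℝ)) = e 0 + f (L fun a => (x a : ℝ)) := by
      rw [← hef, zero_add]
    have h2 : inner ℝ v (f (L fun a => (x a : ℝ))) = 2 * ∑ a, u a * x a := by
      rw [← hfu, LinearIsometryEquiv.inner_map_map]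
      exact inner_map_eq hL u (by exact_mod_cast hx)
    rw [h1, inner_add_right, h2, hc', div_le_iff₀ two_pos]
    constructor <;> intro h <;> linarith
  have hpos : ∀ x : ι → ℤ, e (L (pos (fun _ => u) x)) = e (L fun a => (x a : ℝ)) + v := by
    intro x
    rw [← hfu, ← hef, ← map_add]
    rfl
  refine not_isCompletelySaturated_of_improvable (Φ := fun z => e (L z)) (fun y z => ?_) ?_
    (isPacking_gap_halfSpace u c') (improvable_gap hcard hab c')
  · rw [e.dist_eq, dist_eq_norm, ← map_sub, hL]
    rfl
  · have hon : ∀ x : ι → ℤ, c' ≤ ∑ a, u a * x a →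
        pos (gap {x | c' ≤ ∑ a, u a * x a} u) x = pos (fun _ => u) x := by
      intro x hx
      have hg : gap {x : ι → ℤ | c' ≤ ∑ a, u a * x a} u x = u := if_pos hx
      unfold pos
      rw [hg]
    have hoff : ∀ x : ι → ℤ, ¬ c' ≤ ∑ a, u a * x a →
        pos (gap {x | c' ≤ ∑ a, u a * x a} u) x = fun a => (x a : ℝ) := by
      intro x hx
      have hg : gap {x : ι → ℤ | c' ≤ ∑ a, u a * x a} u x = 0 := if_neg hx
      unfold pos
      rw [hg]
      simp
    ext w
    simp only [SpherePacking.gapDefect, he, hS₀]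
    constructor
    · rintro (⟨⟨_, ⟨x, hx, rfl⟩, rfl⟩, hw⟩ | ⟨_, ⟨⟨_, ⟨x, hx, rfl⟩, rfl⟩, hw⟩, rfl⟩)
      · refine ⟨x, hx, ?_⟩
        rw [hoff x fun h => not_le.2 hw ((hinner x hx).2 h)]
      · refine ⟨x, hx, ?_⟩
        rw [hon x ((hinner x hx).1 hw), hpos]
    · rintro ⟨x, hx, rfl⟩
      by_cases h : c' ≤ ∑ a, u a * x a
      · refine Or.inr ⟨_, ⟨⟨_, ⟨x, hx, rfl⟩, rfl⟩, (hinner x hx).2 h⟩, ?_⟩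
        rw [hon x h, hpos]
      · rw [hoff x h]
        exact Or.inl ⟨⟨_, ⟨x, hx, rfl⟩, rfl⟩, not_le.1 fun h' => h ((hinner x hx).1 h')⟩

/-- The coordinates in which the honeycomb packing is the root lattice `A₂`. -/
noncomputable def honeycombMap : (Fin 3 → ℝ) →ₗ[ℝ] EuclideanSpace ℝ (Fin 2) where
  toFun z := !₂[z 0 - z 1, (z 0 + z 1 - 2 * z 2) / √3]
  map_add' y z := by
    ext i
    fin_cases i <;> simp <;> ring
  map_smul' r z := by
    ext i
    fin_cases i <;> simp <;> ring

/-- The coordinates in which the fcc packing is the root lattice `A₃`. -/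
noncomputable def fccMap : (Fin 4 → ℝ) →ₗ[ℝ] EuclideanSpace ℝ (Fin 3) where
  toFun z := !₂[z 0 - z 1, z 2 - z 3, (z 0 + z 1 - z 2 - z 3) / √2]
  map_add' y z := by
    ext i
    fin_cases i <;> simp <;> ring
  map_smul' r z := by
    ext i
    fin_cases i <;> simp <;> ring

theorem norm_honeycombMap_sq (z : Fin 3 → ℝ) : ‖honeycombMap z‖ ^ 2 = 2 * devSq z := by
  rw [EuclideanSpace.norm_sq_eq]
  simp only [honeycombMap, LinearMap.coe_mk, AddHom.coe_mk, Fin.sum_univ_two, devSq,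
    Fin.sum_univ_three, Fintype.card_fin, Real.norm_eq_abs, sq_abs]
  simp [div_pow]
  ring

theorem norm_fccMap_sq (z : Fin 4 → ℝ) : ‖fccMap z‖ ^ 2 = 2 * devSq z := by
  rw [EuclideanSpace.norm_sq_eq]
  simp only [fccMap, LinearMap.coe_mk, AddHom.coe_mk, Fin.sum_univ_three, devSq,
    Fin.sum_univ_four, Fintype.card_fin, Real.norm_eq_abs, sq_abs]
  simp [div_pow]
  ring

theorem honeycombMap_surjective : Function.Surjective honeycombMap := by
  intro w
  refine ⟨![w 0, 0, (w 0 - √3 * w 1) / 2], ?_⟩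
  have h3 : √3 ≠ 0 := by positivity
  ext i
  fin_cases i
  · simp [honeycombMap]
  · simp [honeycombMap]
    field_simp
    ring

theorem fccMap_surjective : Function.Surjective fccMap := by
  intro w
  refine ⟨![w 0, 0, (w 0 + w 1 - √2 * w 2) / 2, (w 0 - w 1 - √2 * w 2) / 2], ?_⟩
  have h2 : √2 ≠ 0 := by positivity
  ext i
  fin_cases i
  · simp [fccMap]
  · simp [fccMap]
    ring
  · simp [fccMap]
    field_simp
    ring

theorem honeycomb_centers : SpherePacking.honeycomb.centers =
    {w | ∃ x : Fin 3 → ℤ, ∑ a, x a = 0 ∧ w = honeycombMap fun a => (x a : ℝ)} := by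
  have h3 : √3 ≠ 0 := by positivity
  have hsq : √3 ^ 2 = 3 := Real.sq_sqrt (by norm_num)
  ext w
  constructor
  · rintro ⟨i, j, rfl⟩
    refine ⟨![i + j, -i, -j], by simp [Fin.sum_univ_three], ?_⟩
    ext a
    fin_cases a
    · simp [honeycombMap]
      ring
    · simp [honeycombMap]
      field_simp
      rw [hsq]
      ring
  · rintro ⟨x, hx, rfl⟩
    refine ⟨-x 1, -x 2, ?_⟩
    rw [Fin.sum_univ_three] at hx
    have h0 : (x 0 : ℝ) = -x 1 - x 2 := by
      have : x 0 = -x 1 - x 2 := by omega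
      rw [this]
      push_cast
      ring
    ext a
    fin_cases a
    · simp [honeycombMap, h0]
      ring
    · simp [honeycombMap, h0]
      field_simp
      rw [hsq]
      ring

theorem fcc_centers : SpherePacking.fcc.centers =
    {w | ∃ x : Fin 4 → ℤ, ∑ a, x a = 0 ∧ w = fccMap fun a => (x a : ℝ)} := by
  have h2 : √2 ≠ 0 := by positivity
  have hsq : √2 ^ 2 = 2 := Real.sq_sqrt (by norm_num)
  ext w
  constructor
  · rintro ⟨i, j, k, rfl⟩
    refine ⟨![i + k, -i, j, -j - k], by simp [Fin.sum_univ_four]; ring, ?_⟩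
    ext a
    fin_cases a
    · simp [fccMap]
      ring
    · simp [fccMap]
      ring
    · simp [fccMap]
      field_simp
      rw [hsq]
      ring
  · rintro ⟨x, hx, rfl⟩
    refine ⟨-x 1, x 2, x 0 + x 1, ?_⟩
    rw [Fin.sum_univ_four] at hx
    have h0 : (x 3 : ℝ) = -x 0 - x 1 - x 2 := by
      have : x 3 = -x 0 - x 1 - x 2 := by omega
      rw [this]
      push_cast
      ring
    ext a
    fin_cases a
    · simp [fccMap]
      ring
    · simp [fccMap, h0]
      ring
    · simp [fccMap, h0]
      field_simp
      rw [hsq]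
      ring

end SpherePackings
end RootPacking

theorem mainTheorem1 :
    (∀ S : SpherePacking 2, S.IsHoneycomb →
      ∀ (v : EuclideanSpace ℝ (Fin 2)) (c : ℝ), v ≠ 0 →
        ¬ (S.gapDefect v c).IsCompletelySaturated) ∧
    (∀ S : SpherePacking 3, S.IsFCC →
      ∀ (v : EuclideanSpace ℝ (Fin 3)) (c : ℝ), v ≠ 0 →
        ¬ (S.gapDefect v c).IsCompletelySaturated) :=
  ⟨fun _ hS _ c hv => RootPacking.not_isCompletelySaturated_gapDefect (by simp)
      RootPacking.norm_honeycombMap_sq RootPacking.honeycombMap_surjective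
      RootPacking.honeycomb_centers hS hv c,
    fun _ hS _ c hv => RootPacking.not_isCompletelySaturated_gapDefect (by simp)
      RootPacking.norm_fccMap_sq RootPacking.fccMap_surjective RootPacking.fcc_centers hS hv c⟩
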